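/- Let $d\ge 2$ and let $\Omega\subset\mathbb C$ be a bounded, simply connected open set with $C^2$ boundary. Let $\gamma_1,\dots,\gamma_d:\Omega\to\Omega$ be holomorphic maps that extend continuously to $\overline\Omega$ and satisfy $\overline{\gamma_j(\Omega)}\subset\Omega$, and let $G:\Omega\to\mathbb C$ be holomorphic with a continuous extension to $\overline\Omega$. For a Hilbert space $E$ let $H^2(\Omega,E)$ be the Bergman space of holomorphic functions $F:\Omega\to E$ with $\int_\Omega\|F\|^2\,dm<\infty$, where $m$ is Lebesgue measure, and let $B_\Omega(z,w)$ be the Bergman kernel, that is, the reproducing kernel of $H^2(\Omega,\mathbb C)$. For $N\in\mathbb N$ choose $\sigma_1,\dots,\sigma_d$ independently and uniformly in the symmetric group $\mathcal S_N$, let $U_j$ be the $N\times N$ permutation matrix of $\sigma_j$, and let $\mathbb E_N$ denote expectation. Let $\mathscr L_N$ be the bounded operator on $H^2(\Omega,\mathbb C^N)$ given by $$\mathscr L_N(F)(z)=\sum_{j=1}^d e^{G(\gamma_j z)}\,U_jF(\gamma_j z).$$ For a compact operator $T$ let $\mu_0(T)\ge\mu_1(T)\ge\dots$ be its singular values, that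 is, the eigenvalues of $\sqrt{T^*T}$ in decreasing order, repeated according to multiplicity (and followed by zeros if only finitely many are positive). Set $\|\mathscr L_N\|_2^2=\sum_{j\ge0}\mu_j(\mathscr L_N)^2$ and, for $i,j\in\{1,\dots,d\}$, $$H_{i,j}=\int_\Omega e^{G(\gamma_i z)}\,e^{\overline{G(\gamma_j z)}}\,B_\Omega(\gamma_i z,\gamma_j z)\,dm(z).$$ Then $\mathscr L_N$ is compact and $\|\mathscr L_N\|_2^2$ is finite for every $N$ and every choice of the permutations, the integrals $H_{i,j}$ converge absolutely, and the following hold. 1. One has $\lim_{N\to\infty}\frac{\mathbb E_N(\|\mathscr L_N\|_2^2)}{N}=L_1$, where $$L_1=\sum_{j=1}^d\int_\Omega\bigl|e^{G(\gamma_j z)}\bigr|^2B_\Omega(\gamma_j z,\gamma_j z)\,dm(z)>0.$$ 2. For every integer $k\ge1$ the limit $$\lim_{N\to\infty}\mathbb E_N\Bigl(\bigl|\,\|\mathscr L_N\|_2^2-\mathbb E_N(\|\mathscr L_N\|_2^2)\bigr|^{2k}\Bigr)$$ exists and is finite. 3. As $N\to\infty$, the random variable $X_N=\|\mathscr L_N\|_2^2-\mathbb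 E_N(\|\mathscr L_N\|_2^2)$ converges in distribution to $$2\sum_{1\le i<j\le d}(Z_{i,j}-1)\,\Re(H_{i,j}),$$ where the $Z_{i,j}$, $i<j$, are independent Poisson variables with parameter $1$. -/

import Mathlib

open MeasureTheory ProbabilityTheory TopologicalSpace Filter Topology
open scoped ENNReal NNReal InnerProductSpace

noncomputable section

/-! ### Bergman spaces -/

namespace Bergman

section General

variable {E : Type*} [NormedAddCommGroup E] [InnerProductSpace ℂ E] [CompleteSpace E]

/-- Area mean value property. -/
theorem setIntegral_closedBall_eq {F : ℂ → E} {z : ℂ} {r : ℝ} {U : Set ℂ}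
    (hF : DifferentiableOn ℂ F U) (hz : Metric.closedBall z r ⊆ U) :
    ∫ w in Metric.closedBall (0 : ℂ) r, F (z + w)
      = (volume (Metric.closedBall (0 : ℂ) r)).toReal • F z := by
  have hcirc : ∀ w ∈ Metric.closedBall (0 : ℂ) r,
      ∫ θ in (0 : ℝ)..2 * Real.pi, F (z + Complex.exp (θ * Complex.I) * w)
        = (2 * Real.pi) • F z := by
    intro w hw
    rw [mem_closedBall_zero_iff] at hw
    have h1 : DiffContOnCl ℂ F (Metric.ball z |‖w‖|) := by
      apply DifferentiableOn.diffContOnCl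
      refine hF.mono (Metric.closure_ball_subset_closedBall.trans
        ((Metric.closedBall_subset_closedBall ?_).trans hz))
      simpa using hw
    have h2 := h1.circleAverage
    rw [Real.circleAverage, inv_smul_eq_iff₀ (by positivity)] at h2
    rw [← h2]
    have hper : Function.Periodic (fun θ : ℝ => F (circleMap z ‖w‖ θ)) (2 * Real.pi) :=
      (periodic_circleMap z ‖w‖).comp F
    have h3 := hper.intervalIntegral_add_eq 0 (Complex.arg w)
    rw [zero_add] at h3
    rw [h3]
    have h4 := intervalIntegral.integral_comp_add_right (a := 0) (b := 2 * Real.pi)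
      (fun θ : ℝ => F (circleMap z ‖w‖ θ)) (Complex.arg w)
    rw [zero_add, add_comm (2 * Real.pi)] at h4
    rw [← h4]
    congr 1
    funext θ
    congr 1
    rw [circleMap]
    congr 1
    push_cast
    rw [add_mul, Complex.exp_add]
    conv_lhs => rw [← Complex.norm_mul_exp_arg_mul_I w]
    ring
  have hrot : ∀ θ : ℝ, ∫ w in Metric.closedBall (0 : ℂ) r,
      F (z + Complex.exp (θ * Complex.I) * w) = ∫ w in Metric.closedBall (0 : ℂ) r, F (z + w) := by
    intro θ
    have hmp := (rotation (Circle.exp θ)).measurePreserving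
    have hpre : (rotation (Circle.exp θ)) ⁻¹' (Metric.closedBall (0 : ℂ) r)
        = Metric.closedBall (0 : ℂ) r := by
      ext w
      simp only [Set.mem_preimage, mem_closedBall_zero_iff, LinearIsometryEquiv.norm_map]
    have h5 := hmp.setIntegral_preimage_emb
      (rotation (Circle.exp θ)).toHomeomorph.measurableEmbedding
      (fun w => F (z + w)) (Metric.closedBall (0 : ℂ) r)
    rw [hpre] at h5
    rw [← h5]
    simp [rotation_apply]
  have hint : Integrable (Function.uncurry fun (θ : ℝ) (w : ℂ) =>
      F (z + Complex.exp (θ * Complex.I) * w))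
      ((volume.restrict (Set.Ioc 0 (2 * Real.pi))).prod
        (volume.restrict (Metric.closedBall (0 : ℂ) r))) := by
    rw [Measure.prod_restrict]
    have hc : ContinuousOn (Function.uncurry fun (θ : ℝ) (w : ℂ) =>
        F (z + Complex.exp (θ * Complex.I) * w))
        (Set.Icc 0 (2 * Real.pi) ×ˢ Metric.closedBall (0 : ℂ) r) := by
      refine hF.continuousOn.comp (f := fun p : ℝ × ℂ => z + Complex.exp (p.1 * Complex.I) * p.2)
        (by fun_prop) ?_
      rintro ⟨θ, w⟩ ⟨-, hw⟩
      apply hz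
      rw [mem_closedBall_zero_iff] at hw
      rw [Metric.mem_closedBall, dist_eq_norm]
      simpa [Complex.norm_exp_ofReal_mul_I] using hw
    exact (hc.integrableOn_compact (isCompact_Icc.prod (isCompact_closedBall _ _))).mono_set
      (Set.prod_mono_left Set.Ioc_subset_Icc_self)
  have hswap := integral_integral_swap hint
  simp only [hrot] at hswap
  have hconst : ∫ w in Metric.closedBall (0 : ℂ) r, ∫ θ in Set.Ioc 0 (2 * Real.pi),
      F (z + Complex.exp (θ * Complex.I) * w)
        = ∫ _ in Metric.closedBall (0 : ℂ) r, (2 * Real.pi) • F z := by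
    refine setIntegral_congr_fun Metric.isClosed_closedBall.measurableSet fun w hw => ?_
    have := hcirc w hw
    rwa [intervalIntegral.integral_of_le (by positivity)] at this
  rw [hconst] at hswap
  simp only [integral_const] at hswap
  have hpi : (2 * Real.pi) ≠ 0 := by positivity
  simp only [measureReal_restrict_apply_univ, Real.volume_real_Ioc, sub_zero] at hswap
  rw [max_eq_left (by positivity), smul_comm _ (2 * Real.pi)] at hswap
  exact smul_right_injective E hpi hswap

/-- Pointwise values of a square integrable holomorphic function are controlled by its
`L²` norm, uniformly over centres of discs of a fixed radius contained in the domain. -/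
theorem exists_norm_le {r : ℝ} (hr : 0 < r) : ∃ C : ℝ, 0 ≤ C ∧
    ∀ (U : Set ℂ) (F : ℂ → E), DifferentiableOn ℂ F U →
      MemLp F 2 (volume.restrict U) → ∀ z, Metric.closedBall z r ⊆ U →
        ‖F z‖ ≤ C * (eLpNorm F 2 (volume.restrict U)).toReal := by
  set V : ℝ := (volume (Metric.closedBall (0 : ℂ) r)).toReal with hV
  have hVfin : volume (Metric.closedBall (0 : ℂ) r) ≠ ∞ := measure_closedBall_lt_top.ne
  have hVpos : 0 < V := ENNReal.toReal_pos (Metric.measure_closedBall_pos _ _ hr).ne' hVfin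
  set D : ℝ≥0∞ := volume (Metric.closedBall (0 : ℂ) r) ^
    (1 / (1 : ℝ≥0∞).toReal - 1 / (2 : ℝ≥0∞).toReal) with hD
  have hDfin : D ≠ ∞ := by
    apply ENNReal.rpow_ne_top_of_nonneg _ hVfin
    norm_num
  refine ⟨V⁻¹ * D.toReal, by positivity, ?_⟩
  intro U F hF hL z hz
  have h1 := setIntegral_closedBall_eq hF hz
  have hmp : MeasurePreserving (fun w : ℂ => z + w) volume volume :=
    measurePreserving_add_left volume z
  have hpre : (fun w : ℂ => z + w) ⁻¹' (Metric.closedBall z r) = Metric.closedBall (0 : ℂ) r := by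
    ext w; simp
  have h2 := hmp.setIntegral_preimage_emb (measurableEmbedding_addLeft z) F (Metric.closedBall z r)
  rw [hpre, h1] at h2
  have hvol : volume (Metric.closedBall z r) = volume (Metric.closedBall (0 : ℂ) r) := by
    rw [← hpre, hmp.measure_preimage_emb (measurableEmbedding_addLeft z)]
  have hLb : MemLp F 2 (volume.restrict (Metric.closedBall z r)) :=
    hL.mono_measure (Measure.restrict_mono hz le_rfl)
  have h3 : eLpNorm F 1 (volume.restrict (Metric.closedBall z r))
      ≤ eLpNorm F 2 (volume.restrict U) * D := by
    refine (eLpNorm_le_eLpNorm_mul_rpow_measure_univ (p := 1) (q := 2) (by norm_num)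
      hLb.aestronglyMeasurable).trans ?_
    rw [Measure.restrict_apply_univ, hvol]
    gcongr
  have h4 : V * ‖F z‖ ≤ (eLpNorm F 2 (volume.restrict U)).toReal * D.toReal := by
    have h5 : ‖V • F z‖ₑ ≤ eLpNorm F 2 (volume.restrict U) * D := by
      rw [hV, h2]
      refine (enorm_integral_le_lintegral_enorm _).trans ?_
      rwa [← eLpNorm_one_eq_lintegral_enorm]
    have h6 := ENNReal.toReal_mono (ENNReal.mul_ne_top hL.2.ne hDfin) h5
    rw [ENNReal.toReal_mul, toReal_enorm, norm_smul, Real.norm_of_nonneg hVpos.le] at h6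
    exact h6
  calc ‖F z‖ = V⁻¹ * (V * ‖F z‖) := by field_simp
    _ ≤ V⁻¹ * ((eLpNorm F 2 (volume.restrict U)).toReal * D.toReal) := by gcongr
    _ = _ := by ring

/-- The square integrable holomorphic functions `Ω → E`, as a subspace of `L²(Ω, E)`
(Lebesgue measure on `ℂ`): the classes of functions that have a representative which is
holomorphic on `Ω`. The inner product and the norm are those of `L²(Ω, E)`. -/
def space (Ω : Opens ℂ) (E : Type*) [NormedAddCommGroup E] [InnerProductSpace ℂ E] :
    Submodule ℂ (Lp E 2 (volume.restrict (Ω : Set ℂ))) where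
  carrier := {f | ∃ F : ℂ → E, DifferentiableOn ℂ F Ω ∧ f =ᵐ[volume.restrict (Ω : Set ℂ)] F}
  zero_mem' := ⟨0, differentiableOn_const _, Lp.coeFn_zero _ _ _⟩
  add_mem' := by
    rintro f g ⟨F, hF, hfF⟩ ⟨G, hG, hgG⟩
    exact ⟨F + G, hF.add hG, (Lp.coeFn_add f g).trans (hfF.add hgG)⟩
  smul_mem' := by
    rintro c f ⟨F, hF, hfF⟩
    exact ⟨c • F, hF.const_smul c, (Lp.coeFn_smul c f).trans (hfF.const_smul c)⟩

end General

end Bergman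

/-- The Bergman space `H²(Ω, E)`. -/
abbrev BergmanSpace (Ω : Opens ℂ) (E : Type*) [NormedAddCommGroup E] [InnerProductSpace ℂ E] :
    Type _ := Bergman.space Ω E

namespace Bergman

variable {Ω : Opens ℂ} {E : Type*} [NormedAddCommGroup E] [InnerProductSpace ℂ E]

/-- A holomorphic representative of an element of the Bergman space (unique on `Ω`). -/
def rep (f : BergmanSpace Ω E) : ℂ → E := f.2.choose

theorem rep_differentiableOn (f : BergmanSpace Ω E) : DifferentiableOn ℂ (rep f) Ω :=
  f.2.choose_spec.1

theorem rep_ae_eq (f : BergmanSpace Ω E) :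
    (f : Lp E 2 (volume.restrict (Ω : Set ℂ))) =ᵐ[volume.restrict (Ω : Set ℂ)] rep f :=
  f.2.choose_spec.2

theorem rep_eqOn (f : BergmanSpace Ω E) {F : ℂ → E} (hF : DifferentiableOn ℂ F Ω)
    (hfF : (f : Lp E 2 (volume.restrict (Ω : Set ℂ))) =ᵐ[volume.restrict (Ω : Set ℂ)] F) :
    Set.EqOn (rep f) F Ω :=
  Measure.eqOn_open_of_ae_eq ((rep_ae_eq f).symm.trans hfF) Ω.isOpen
    (rep_differentiableOn f).continuousOn hF.continuousOn

theorem rep_memLp (f : BergmanSpace Ω E) : MemLp (rep f) 2 (volume.restrict (Ω : Set ℂ)) :=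
  (memLp_congr_ae (rep_ae_eq f)).1 (Lp.memLp f.1)

theorem eLpNorm_rep (f : BergmanSpace Ω E) :
    (eLpNorm (rep f) 2 (volume.restrict (Ω : Set ℂ))).toReal = ‖f‖ := by
  rw [← eLpNorm_congr_ae (rep_ae_eq f)]
  rfl

theorem rep_add (f g : BergmanSpace Ω E) : Set.EqOn (rep (f + g)) (rep f + rep g) Ω :=
  rep_eqOn _ ((rep_differentiableOn f).add (rep_differentiableOn g))
    ((Lp.coeFn_add f.1 g.1).trans ((rep_ae_eq f).add (rep_ae_eq g)))

theorem rep_smul (c : ℂ) (f : BergmanSpace Ω E) : Set.EqOn (rep (c • f)) (c • rep f) Ω :=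
  rep_eqOn _ ((rep_differentiableOn f).const_smul c)
    ((Lp.coeFn_smul c f.1).trans ((rep_ae_eq f).const_smul c))

/-- Evaluation of an element of the Bergman space at the points of `Ω`. -/
def evalLinear (Ω : Opens ℂ) (E : Type*) [NormedAddCommGroup E] [InnerProductSpace ℂ E] :
    BergmanSpace Ω E →ₗ[ℂ] (Ω → E) where
  toFun f z := rep f z
  map_add' f g := by funext z; exact rep_add f g z.2
  map_smul' c f := by funext z; exact rep_smul c f z.2

theorem memLp_of_bound (hfin : volume (Ω : Set ℂ) ≠ ∞) {F : ℂ → E}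
    (hF : DifferentiableOn ℂ F Ω) {C : ℝ} (hC : ∀ z ∈ Ω, ‖F z‖ ≤ C) :
    MemLp F 2 (volume.restrict (Ω : Set ℂ)) := by
  have : IsFiniteMeasure (volume.restrict (Ω : Set ℂ)) := isFiniteMeasure_restrict.2 hfin
  refine MemLp.of_bound (hF.continuousOn.aestronglyMeasurable Ω.isOpen.measurableSet) C ?_
  filter_upwards [ae_restrict_mem Ω.isOpen.measurableSet] with z hz using hC z hz

variable [CompleteSpace E]

theorem exists_norm_rep_le {K : Set ℂ} (hK : IsCompact K) (hKΩ : K ⊆ Ω) :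
    ∃ C : ℝ, 0 ≤ C ∧ ∀ f : BergmanSpace Ω E, ∀ z ∈ K, ‖rep f z‖ ≤ C * ‖f‖ := by
  obtain ⟨δ, hδ, hsub⟩ := hK.exists_cthickening_subset_open Ω.isOpen hKΩ
  obtain ⟨C, hC, h⟩ := exists_norm_le (E := E) hδ
  refine ⟨C, hC, fun f z hz => ?_⟩
  rw [← eLpNorm_rep]
  exact h Ω _ (rep_differentiableOn f) (rep_memLp f) z
    ((Metric.closedBall_subset_cthickening hz δ).trans hsub)

theorem isClosed_space : IsClosed (space Ω E : Set (Lp E 2 (volume.restrict (Ω : Set ℂ)))) := by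
  rw [← isSeqClosed_iff_isClosed]
  intro u f hu hlim
  let v : ℕ → BergmanSpace Ω E := fun n => ⟨u n, hu n⟩
  have hcau : CauchySeq v := by
    have : CauchySeq u := hlim.cauchySeq
    rw [Metric.cauchySeq_iff] at this ⊢
    exact this
  have hunif : ∀ K ⊆ (Ω : Set ℂ), IsCompact K →
      UniformCauchySeqOn (fun n => rep (v n)) atTop K := by
    intro K hKΩ hK
    obtain ⟨C, hC, h⟩ := exists_norm_rep_le (E := E) hK hKΩ
    rw [Metric.uniformCauchySeqOn_iff]
    intro ε hε
    rw [Metric.cauchySeq_iff] at hcau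
    obtain ⟨n₀, hn₀⟩ := hcau (ε / (C + 1)) (by positivity)
    refine ⟨n₀, fun m hm n hn z hz => ?_⟩
    have h1 : rep (v m) z - rep (v n) z = rep (v m - v n) z :=
      (congrFun (map_sub (evalLinear Ω E) (v m) (v n)) ⟨z, hKΩ hz⟩).symm
    rw [dist_eq_norm, h1]
    have h2 := hn₀ m hm n hn
    rw [dist_eq_norm, lt_div_iff₀ (by positivity)] at h2
    have h3 := h (v m - v n) z hz
    nlinarith [norm_nonneg (v m - v n)]
  have hpt : ∀ z ∈ (Ω : Set ℂ), ∃ y, Tendsto (fun n => rep (v n) z) atTop (𝓝 y) := by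
    intro z hz
    exact cauchySeq_tendsto_of_complete
      ((hunif {z} (Set.singleton_subset_iff.2 hz) isCompact_singleton).cauchySeq rfl)
  choose! F hF using hpt
  have hloc : TendstoLocallyUniformlyOn (fun n => rep (v n)) F atTop (Ω : Set ℂ) := by
    rw [tendstoLocallyUniformlyOn_iff_forall_isCompact Ω.isOpen]
    intro K hKΩ hK
    exact (hunif K hKΩ hK).tendstoUniformlyOn_of_tendsto fun z hz => hF z (hKΩ hz)
  refine ⟨F, hloc.differentiableOn (Eventually.of_forall fun n => rep_differentiableOn (v n))
    Ω.isOpen, ?_⟩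
  obtain ⟨ns, hns, hae⟩ := (tendstoInMeasure_of_tendsto_Lp hlim).exists_seq_tendsto_ae
  have hall : ∀ᵐ z ∂(volume.restrict (Ω : Set ℂ)), ∀ n, (u n) z = rep (v n) z :=
    ae_all_iff.2 fun n => rep_ae_eq (v n)
  filter_upwards [hae, hall, ae_restrict_mem Ω.isOpen.measurableSet] with z h1 h2 hz
  refine tendsto_nhds_unique h1 ?_
  simp only [h2]
  exact (hF z hz).comp hns.tendsto_atTop

instance : CompleteSpace (BergmanSpace Ω E) :=
  (isClosed_space (Ω := Ω) (E := E)).completeSpace_coe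

theorem continuous_evalLinear : Continuous (evalLinear Ω E) := by
  refine continuous_pi fun z => ?_
  obtain ⟨C, -, h⟩ := exists_norm_rep_le (E := E) (isCompact_singleton (x := (z : ℂ)))
    (Set.singleton_subset_iff.2 z.2)
  exact (LinearMap.mkContinuous ((LinearMap.proj z).comp (evalLinear Ω E)) C
    fun f => h f z rfl).continuous

/-- `H²(Ω, E)` as a reproducing kernel Hilbert space of functions on `Ω`: an element is
regarded as the holomorphic function on `Ω` that represents it. -/
instance : RKHS ℂ (BergmanSpace Ω E) Ω E where
  coeCLM := ⟨evalLinear Ω E, continuous_evalLinear⟩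
  coeCLM_injective := by
    intro f g h
    apply Subtype.ext
    apply Lp.ext
    refine (rep_ae_eq f).trans (EventuallyEq.trans ?_ (rep_ae_eq g).symm)
    filter_upwards [ae_restrict_mem Ω.isOpen.measurableSet] with z hz
    exact congrFun h ⟨z, hz⟩

theorem apply_eq_rep (f : BergmanSpace Ω E) (z : Ω) : f z = rep f z := rfl

/-- The elements of the Bergman space are holomorphic functions on `Ω`. -/
theorem exists_holomorphic (f : BergmanSpace Ω E) :
    ∃ F : ℂ → E, DifferentiableOn ℂ F Ω ∧ ∀ z : Ω, f z = F z :=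
  ⟨rep f, rep_differentiableOn f, fun _ => rfl⟩

/-- Every square integrable holomorphic function on `Ω` is an element of the Bergman space. -/
theorem exists_of_holomorphic {F : ℂ → E} (hF : DifferentiableOn ℂ F Ω)
    (hL : MemLp F 2 (volume.restrict (Ω : Set ℂ))) : ∃ f : BergmanSpace Ω E, ∀ z : Ω, f z = F z :=
  ⟨⟨hL.toLp, F, hF, hL.coeFn_toLp⟩, fun z => rep_eqOn _ hF hL.coeFn_toLp z.2⟩

/-- Extension by zero to `ℂ` of the function on `Ω` given by an element of the Bergman space. -/
def extend (f : BergmanSpace Ω E) (z : ℂ) : E := by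
  classical exact if h : z ∈ Ω then f ⟨z, h⟩ else 0

theorem extend_eqOn (f : BergmanSpace Ω E) : Set.EqOn (extend f) (rep f) Ω := by
  intro z hz
  have hz' : z ∈ Ω := hz
  simp only [extend, hz', dif_pos]
  rfl

theorem extend_add (f g : BergmanSpace Ω E) : extend (f + g) = extend f + extend g := by
  funext z
  by_cases h : z ∈ Ω <;> simp [extend, h]

theorem extend_smul (c : ℂ) (f : BergmanSpace Ω E) : extend (c • f) = c • extend f := by
  funext z
  by_cases h : z ∈ Ω
  · simp only [extend, h, dif_pos, Pi.smul_apply]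
    exact congrFun (map_smul (RKHS.coeCLM (H := BergmanSpace Ω E) ℂ) c f) ⟨z, h⟩
  · simp [extend, h]

/-- Weighted composition `f ↦ (z ↦ a(z) A f(φ(z)))` is a bounded operator on the Bergman space
of a domain of finite area, if `a` is bounded and holomorphic, `A` is a bounded operator and `φ`
maps `Ω` holomorphically into a compact subset `K` of `Ω`. -/
theorem exists_weightedComp (hfin : volume (Ω : Set ℂ) ≠ ∞) {φ a : ℂ → ℂ} {K : Set ℂ}
    (hK : IsCompact K) (hKΩ : K ⊆ Ω) (hφ : DifferentiableOn ℂ φ Ω)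
    (hφK : Set.MapsTo φ Ω K) (ha : DifferentiableOn ℂ a Ω) {M : ℝ} (haM : ∀ z ∈ Ω, ‖a z‖ ≤ M)
    (A : E →L[ℂ] E) :
    ∃ T : BergmanSpace Ω E →L[ℂ] BergmanSpace Ω E, ∀ (f : BergmanSpace Ω E) (z : Ω),
      T f z = a z • A (extend f (φ z)) := by
  obtain ⟨C, hC, hb⟩ := exists_norm_rep_le (E := E) hK hKΩ
  have hφΩ : Set.MapsTo φ Ω Ω := fun z hz => hKΩ (hφK hz)
  have hdiff : ∀ f : BergmanSpace Ω E,
      DifferentiableOn ℂ (fun z => a z • A (extend f (φ z))) Ω := by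
    intro f
    refine ha.smul (A.differentiable.comp_differentiableOn ?_)
    exact ((rep_differentiableOn f).congr (extend_eqOn f)).comp hφ hφΩ
  have hbd : ∀ f : BergmanSpace Ω E, ∀ z ∈ Ω,
      ‖a z • A (extend f (φ z))‖ ≤ max M 0 * (‖A‖ * (C * ‖f‖)) := by
    intro f z hz
    rw [norm_smul, extend_eqOn f (hφΩ hz)]
    gcongr
    · exact (haM z hz).trans (le_max_left _ _)
    · exact (A.le_opNorm _).trans (by gcongr; exact hb f _ (hφK hz))
  have hex : ∀ f : BergmanSpace Ω E, ∃ g : BergmanSpace Ω E,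
      ∀ z : Ω, g z = a z • A (extend f (φ z)) := fun f =>
    exists_of_holomorphic (hdiff f) (memLp_of_bound hfin (hdiff f) (hbd f))
  choose T hT using hex
  let L : BergmanSpace Ω E →ₗ[ℂ] BergmanSpace Ω E :=
    { toFun := T
      map_add' := fun f g => by
        refine RKHS.ext fun z => ?_
        rw [RKHS.coe_add, Pi.add_apply, hT, hT, hT, extend_add, Pi.add_apply, map_add, smul_add]
      map_smul' := fun c f => by
        refine RKHS.ext fun z => ?_
        rw [RingHom.id_apply, RKHS.coe_smul, Pi.smul_apply, hT, hT, extend_smul, Pi.smul_apply,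
          map_smul, smul_comm] }
  have : IsFiniteMeasure (volume.restrict (Ω : Set ℂ)) := isFiniteMeasure_restrict.2 hfin
  refine ⟨L.mkContinuous ((volume.restrict (Ω : Set ℂ)).real Set.univ ^ (2 : ℝ≥0∞).toReal⁻¹
    * (max M 0 * (‖A‖ * C))) fun f => ?_, fun f z => hT f z⟩
  have h1 : ∀ᵐ z ∂(volume.restrict (Ω : Set ℂ)),
      ‖(T f).1 z‖ ≤ max M 0 * (‖A‖ * (C * ‖f‖)) := by
    filter_upwards [rep_ae_eq (T f), ae_restrict_mem Ω.isOpen.measurableSet] with z h2 hz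
    rw [h2]
    have h3 := hT f ⟨z, hz⟩
    rw [apply_eq_rep] at h3
    rw [h3]
    exact hbd f z hz
  have h4 := Lp.norm_le_of_ae_bound (f := (T f).1) (by positivity) h1
  calc ‖T f‖ = ‖(T f).1‖ := rfl
    _ ≤ _ := h4
    _ = _ := by simp only [measureReal_def, measureUnivNNReal, ENNReal.coe_toNNReal_eq_toReal]; ring

open Classical in
/-- The Bergman kernel `B_Ω(z, w)` for `z, w ∈ Ω`: the reproducing kernel of `H²(Ω, ℂ)`
(the value is `0` if `z` or `w` is not in `Ω`). -/
def kernel (Ω : Opens ℂ) (z w : ℂ) : ℂ :=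
  if h : z ∈ Ω ∧ w ∈ Ω then RKHS.kernel (BergmanSpace Ω ℂ) ⟨z, h.1⟩ ⟨w, h.2⟩ 1 else 0

/-- The reproducing property `f(z) = ∫_Ω B_Ω(z, w) f(w) dm(w)`. -/
theorem kernel_reproducing (f : BergmanSpace Ω ℂ) {z : ℂ} (hz : z ∈ Ω) :
    f ⟨z, hz⟩ = ∫ w in (Ω : Set ℂ), kernel Ω z w * extend f w := by
  set k := RKHS.kerFun (BergmanSpace Ω ℂ) ⟨z, hz⟩ (1 : ℂ) with hk
  have h1 : f ⟨z, hz⟩ = inner ℂ k f := by simp [hk]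
  rw [h1, Submodule.coe_inner, L2.inner_def]
  refine integral_congr_ae ?_
  filter_upwards [rep_ae_eq f, rep_ae_eq k, ae_restrict_mem Ω.isOpen.measurableSet]
    with w hw1 hw2 hw
  have hw' : w ∈ Ω := hw
  rw [hw1, hw2, RCLike.inner_apply, mul_comm, extend_eqOn f hw, kernel, dif_pos ⟨hz, hw'⟩]
  congr 1
  have h3 : inner ℂ (RKHS.kernel (BergmanSpace Ω ℂ) ⟨z, hz⟩ ⟨w, hw'⟩ (1 : ℂ)) (1 : ℂ)
      = inner ℂ (RKHS.kerFun (BergmanSpace Ω ℂ) ⟨w, hw'⟩ (1 : ℂ)) k :=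
    RKHS.kernel_inner _ _ _ _ _
  rw [RKHS.kerFun_inner] at h3
  simp only [RCLike.inner_apply, one_mul, map_one, mul_one] at h3
  rw [← Complex.conj_conj (RKHS.kernel (BergmanSpace Ω ℂ) ⟨z, hz⟩ ⟨w, hw'⟩ (1 : ℂ)), h3]
  rfl

end Bergman

/-! ### The transfer operators -/

/-- The boundary of the open set `Ω ⊆ ℂ` is `C²`-regular: near each boundary point, `Ω` is the
sublevel set of a `C²` function with nonvanishing differential. -/
def HasC2Boundary (Ω : Opens ℂ) : Prop :=
  ∀ p ∈ frontier (Ω : Set ℂ), ∃ (U : Set ℂ) (ρ : ℂ → ℝ), IsOpen U ∧ p ∈ U ∧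
    ContDiffOn ℝ 2 ρ U ∧ fderiv ℝ ρ p ≠ 0 ∧ (Ω : Set ℂ) ∩ U = {z ∈ U | ρ z < 0}

/-- The data: a bounded simply connected open set `Ω` with `C²` boundary, `d` holomorphic maps
`γ_1, …, γ_d` of `Ω` strictly into itself that extend continuously to the closure, and a
holomorphic weight function `G` on `Ω` that extends continuously to the closure.
(The functions are total functions on `ℂ`, whose values on the closure of `Ω` are those of
the continuous extensions and whose values elsewhere play no role.) -/
structure ContractionSystem (d : ℕ) where
  /-- the domain -/
  Ω : Opens ℂ
  isBounded : Bornology.IsBounded (Ω : Set ℂ)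
  isSimplyConnected : IsSimplyConnected (Ω : Set ℂ)
  hasC2Boundary : HasC2Boundary Ω
  /-- the contractions -/
  γ : Fin d → ℂ → ℂ
  differentiableOn_γ : ∀ j, DifferentiableOn ℂ (γ j) Ω
  continuousOn_γ : ∀ j, ContinuousOn (γ j) (closure (Ω : Set ℂ))
  closure_image_subset : ∀ j, closure (γ j '' (Ω : Set ℂ)) ⊆ Ω
  /-- the weight function -/
  G : ℂ → ℂ
  differentiableOn_G : DifferentiableOn ℂ G Ω
  continuousOn_G : ContinuousOn G (closure (Ω : Set ℂ))

namespace ContractionSystem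

variable {d : ℕ} (S : ContractionSystem d)

theorem mapsTo_γ (j : Fin d) : Set.MapsTo (S.γ j) S.Ω S.Ω := fun _ hz =>
  S.closure_image_subset j (subset_closure (Set.mem_image_of_mem _ hz))

/-- `γ_j` as a self-map of `Ω`. -/
def map (j : Fin d) : S.Ω → S.Ω := (S.mapsTo_γ j).restrict

/-- The Hilbert space `H²(Ω, ℂ^N)`. -/
abbrev HilbertSpace (N : ℕ) : Type := BergmanSpace S.Ω (EuclideanSpace ℂ (Fin N))

theorem existsUnique_transferOperator (N : ℕ) (σ : Fin d → Equiv.Perm (Fin N)) :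
    ∃! L : S.HilbertSpace N →L[ℂ] S.HilbertSpace N, ∀ (F : S.HilbertSpace N) (z : S.Ω),
      L F z = ∑ j, Complex.exp (S.G (S.map j z)) •
        Matrix.toEuclideanCLM (𝕜 := ℂ) ((σ j).permMatrix ℂ) (F (S.map j z)) := by
  have hex : ∀ j : Fin d, ∃ T : S.HilbertSpace N →L[ℂ] S.HilbertSpace N,
      ∀ (F : S.HilbertSpace N) (z : S.Ω), T F z = Complex.exp (S.G (S.map j z)) •
        Matrix.toEuclideanCLM (𝕜 := ℂ) ((σ j).permMatrix ℂ) (F (S.map j z)) := by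
    intro j
    have hK : IsCompact (closure (S.γ j '' (S.Ω : Set ℂ))) :=
      (S.isBounded.subset (S.mapsTo_γ j).image_subset).isCompact_closure
    have hexp : ContinuousOn (fun z => Complex.exp (S.G z)) (closure (S.γ j '' (S.Ω : Set ℂ))) :=
      Complex.continuous_exp.comp_continuousOn
        (S.differentiableOn_G.continuousOn.mono (S.closure_image_subset j))
    obtain ⟨M, hM⟩ := hK.exists_bound_of_continuousOn hexp
    obtain ⟨T, hT⟩ := Bergman.exists_weightedComp (E := EuclideanSpace ℂ (Fin N))
      S.isBounded.measure_lt_top.ne hK (S.closure_image_subset j) (S.differentiableOn_γ j)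
      (fun z hz => subset_closure (Set.mem_image_of_mem _ hz))
      (a := fun z => Complex.exp (S.G (S.γ j z)))
      ((S.differentiableOn_G.comp (S.differentiableOn_γ j) (S.mapsTo_γ j)).cexp)
      (fun z hz => hM _ (subset_closure (Set.mem_image_of_mem _ hz)))
      (Matrix.toEuclideanCLM (𝕜 := ℂ) ((σ j).permMatrix ℂ))
    refine ⟨T, fun F z => ?_⟩
    rw [hT, Bergman.extend_eqOn F (S.mapsTo_γ j z.2)]
    rfl
  choose T hT using hex
  have hsum : ∀ (F : S.HilbertSpace N) (z : S.Ω), (∑ j, T j) F z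
      = ∑ j, Complex.exp (S.G (S.map j z)) •
        Matrix.toEuclideanCLM (𝕜 := ℂ) ((σ j).permMatrix ℂ) (F (S.map j z)) := by
    intro F z
    rw [sum_apply, ← RKHS.coeCLM_apply, map_sum, Finset.sum_apply]
    exact Finset.sum_congr rfl fun j _ => hT j F z
  refine ⟨∑ j, T j, hsum, fun L hL => ?_⟩
  exact ContinuousLinearMap.ext fun F => RKHS.ext fun z => (hL F z).trans (hsum F z).symm

/-- The twisted transfer operator on `H²(Ω, ℂ^N)`,
`(L F)(z) = ∑_j e^{G(γ_j z)} U_j F(γ_j z)`, where `U_j` is the permutation matrix of `σ_j`. -/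
def transferOperator (N : ℕ) (σ : Fin d → Equiv.Perm (Fin N)) :
    S.HilbertSpace N →L[ℂ] S.HilbertSpace N :=
  (S.existsUnique_transferOperator N σ).choose

theorem transferOperator_apply (N : ℕ) (σ : Fin d → Equiv.Perm (Fin N))
    (F : S.HilbertSpace N) (z : S.Ω) :
    S.transferOperator N σ F z = ∑ j, Complex.exp (S.G (S.map j z)) •
      Matrix.toEuclideanCLM (𝕜 := ℂ) ((σ j).permMatrix ℂ) (F (S.map j z)) :=
  (S.existsUnique_transferOperator N σ).choose_spec.1 F z

/-- The integrand of `H_{i,j}`. -/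
def bergmanIntegrand (i j : Fin d) (z : ℂ) : ℂ :=
  Complex.exp (S.G (S.γ i z)) * Complex.exp (starRingEnd ℂ (S.G (S.γ j z))) *
    Bergman.kernel S.Ω (S.γ i z) (S.γ j z)

/-- `H_{i,j} = ∫_Ω e^{G(γ_i z)} e^{conj G(γ_j z)} B_Ω(γ_i z, γ_j z) dm(z)`. -/
def bergmanIntegral (i j : Fin d) : ℂ :=
  ∫ z in (S.Ω : Set ℂ), S.bergmanIntegrand i j z

end ContractionSystem

/-! ### Singular values -/

section SingularValues

variable {H : Type*} [NormedAddCommGroup H] [InnerProductSpace ℂ H] [CompleteSpace H]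

/-- The sum of the eigenspaces of `√(T* T)` for the eigenvalues `s > t`. -/
def spectralSubspace (T : H →L[ℂ] H) (t : ℝ) : Submodule ℂ H :=
  ⨆ s ∈ Set.Ioi t, Module.End.eigenspace (CFC.abs T).toLinearMap (s : ℂ)

/-- The singular values `μ_0(T) ≥ μ_1(T) ≥ …` of a compact operator `T`: the eigenvalues of
`√(T* T)` in decreasing order, repeated according to multiplicity, and followed by zeros if there
are only finitely many positive ones. That is, `μ_j(T)` is the least `t ≥ 0` such that at most `j`
eigenvalues, counted with multiplicity, exceed `t`. -/
def singularValue (T : H →L[ℂ] H) (j : ℕ) : ℝ :=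
  sInf {t : ℝ | 0 ≤ t ∧ Module.rank ℂ (spectralSubspace T t) ≤ j}

/-- `‖T‖_2² = ∑_j μ_j(T)²`. -/
def hilbertSchmidtSq (T : H →L[ℂ] H) : ℝ := ∑' j, singularValue T j ^ 2

end SingularValues

/-! ### Random permutations -/

instance Equiv.Perm.measurableSpaceFin (N : ℕ) : MeasurableSpace (Equiv.Perm (Fin N)) := ⊤

instance Equiv.Perm.discreteMeasurableSpaceFin (N : ℕ) :
    DiscreteMeasurableSpace (Equiv.Perm (Fin N)) := ⟨fun _ => trivial⟩

/-- The law `ℙ_N` of `d` independent uniformly distributed permutations of `N` points. -/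
def permLaw (d N : ℕ) : Measure (Fin d → Equiv.Perm (Fin N)) :=
  Measure.pi fun _ => uniformOn Set.univ

instance (d N : ℕ) : IsProbabilityMeasure (permLaw d N) := by
  unfold permLaw
  infer_instance

namespace ContractionSystem

variable {d : ℕ} (S : ContractionSystem d)

/-- The random variable `‖L_N‖_2²`, as a function of the permutations. -/
def normSq (N : ℕ) (σ : Fin d → Equiv.Perm (Fin N)) : ℝ :=
  hilbertSchmidtSq (S.transferOperator N σ)

/-- The expectation `𝔼_N(‖L_N‖_2²)`. -/
def meanNormSq (N : ℕ) : ℝ := ∫ σ, S.normSq N σ ∂(permLaw d N)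

/-- The fluctuation `X_N = ‖L_N‖_2² - 𝔼_N(‖L_N‖_2²)`. -/
def fluctuation (N : ℕ) (σ : Fin d → Equiv.Perm (Fin N)) : ℝ :=
  S.normSq N σ - S.meanNormSq N

end ContractionSystem

end

/-! ### Hilbert–Schmidt operators and singular values -/

namespace HilbertBasis

variable {H : Type*} [NormedAddCommGroup H] [InnerProductSpace ℂ H] {ι κ : Type*}

/-! The problem reduces to a Hilbert–Schmidt computation followed by a Poisson limit theorem for the
agreement numbers of random permutations.

The form `F ↦ (L F)(z)_v` is represented by a combination of kernel vectors at the points `γ_j z` in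
the coordinate directions `σ_j v`. Summing `‖L b_k‖²` over a Hilbert basis and using Parseval at
each `z` gives the integral over `Ω` of the squared norms of these vectors, and kernels in distinct
coordinate directions are orthogonal. Hence `‖L‖_2² = ∑_{i,j} a_{ij} Re H_{ij}`, where `a_{ij}`
counts the points at which `σ_i` and `σ_j` agree (`tsum_enorm_transferOperator_sq`, `normSq_eq`);
`tsum_singularValue_sq` identifies the basis sum with the sum over singular values. Since `a_{jj} =
N`, the diagonal is the deterministic main term. For `i < j` the mean of `a_{ij}` is exactly 1 when
`N > 0`, so the fluctuation is `2 ∑ (a_{ij} - 1) Re H_{ij}` without any error term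
(`fluctuation_eq`).

It remains to see that the `a_{ij}`, `i < j`, are jointly close to independent Poisson variables,
although they share permutations. Composing `σ_i` with a transposition preserves the law and gives
an exchange identity (`integral_eq_sum_swapAt`); typically the transposition destroys one agreement
and changes nothing else. This yields the Stein equation `E[a_p g(a)] ≈ E[g(a + e_p)]` with error
`O(N^(-1/2))` (`exists_abs_steinDifference_le`), and by induction the mixed binomial moments tend to
`∏ 1 / k_q!` (`tendsto_integral_prod_choose_agreements`).

Exponential moments of the agreements are bounded in `N`, so a Newton expansion in products of
binomial coefficients extends the convergence to all functions of exponential growth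
(`tendsto_integral_agreements`). Powers of the fluctuation give the moments, bounded continuous
functions of it the limit law. -/

theorem countable_index [SeparableSpace H] (b : HilbertBasis ι ℂ H) : Countable ι := by
  have hdist : ∀ i j, i ≠ j → 1 ≤ dist (b i) (b j) := by
    intro i j hij
    rw [dist_eq_norm]
    have h1 := b.orthonormal.2 hij
    have h2 := @norm_sub_sq ℂ _ _ _ _ (b i) (b j)
    rw [h1, b.orthonormal.1 i, b.orthonormal.1 j] at h2
    simp only [map_zero] at h2
    nlinarith [norm_nonneg (b i - b j)]
  refine Pairwise.countable_of_isOpen_disjoint (s := fun i => Metric.ball (b i) (1 / 2))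
    (fun i j hij => Metric.ball_disjoint_ball (by linarith [hdist i j hij]))
    (fun i => Metric.isOpen_ball) fun i => ⟨b i, Metric.mem_ball_self (by norm_num)⟩

theorem tsum_enorm_inner_sq (b : HilbertBasis ι ℂ H) (x : H) :
    ∑' i, ‖inner ℂ (b i) x‖ₑ ^ 2 = ‖x‖ₑ ^ 2 := by
  have h := b.hasSum_inner_mul_inner x x
  have h2 : HasSum (fun i => ‖inner ℂ (b i) x‖ ^ 2) (‖x‖ ^ 2) := by
    have h3 := Complex.hasSum_re h
    rw [← @inner_self_eq_norm_sq ℂ]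
    convert! h3 using 2 with i
    rw [← inner_conj_symm x (b i), ← Complex.normSq_eq_conj_mul_self]
    rw [Complex.ofReal_re, Complex.normSq_eq_norm_sq]
  have h4 : ∀ y : ℂ, ‖y‖ₑ ^ 2 = ENNReal.ofReal (‖y‖ ^ 2) := fun y => by
    rw [ENNReal.ofReal_pow (norm_nonneg _), ofReal_norm]
  simp_rw [h4]
  rw [← ENNReal.ofReal_tsum_of_nonneg (fun i => by positivity) h2.summable, h2.tsum_eq,
    ENNReal.ofReal_pow (norm_nonneg _), ofReal_norm]

variable [CompleteSpace H]

/-- Both sides are the double sum of the squared matrix coefficients `|⟨c k, T (b i)⟩|²`, taken in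
the two orders. Passing through the adjoint is what makes the sum independent of the basis. -/
theorem tsum_enorm_adjoint_sq (b : HilbertBasis ι ℂ H) (c : HilbertBasis κ ℂ H) (T : H →L[ℂ] H) :
    ∑' k, ‖T.adjoint (c k)‖ₑ ^ 2 = ∑' i, ‖T (b i)‖ₑ ^ 2 := by
  simp_rw [← b.tsum_enorm_inner_sq (T.adjoint _), ← c.tsum_enorm_inner_sq (T _)]
  rw [ENNReal.tsum_comm]
  refine tsum_congr fun i => tsum_congr fun k => ?_
  rw [ContinuousLinearMap.adjoint_inner_right, ← inner_conj_symm, RCLike.enorm_conj]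

theorem tsum_enorm_sq_eq (b : HilbertBasis ι ℂ H) (c : HilbertBasis κ ℂ H) (T : H →L[ℂ] H) :
    ∑' i, ‖T (b i)‖ₑ ^ 2 = ∑' k, ‖T (c k)‖ₑ ^ 2 := by
  rw [← b.tsum_enorm_adjoint_sq b, ← c.tsum_enorm_adjoint_sq b]

/-- By Cauchy–Schwarz and Bessel, the rank-one pieces `x ↦ ⟨b i, x⟩ T (b i)` over a finite set `t`
add up to an operator of squared norm at most the sum of `‖T (b i)‖²` over `t`. So `T` is a norm
limit of finite-rank operators. -/
theorem isCompactOperator_of_summable (b : HilbertBasis ι ℂ H) (T : H →L[ℂ] H)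
    (hT : Summable fun i => ‖T (b i)‖ ^ 2) : IsCompactOperator T := by
  let R : ι → H →L[ℂ] H := fun i => (innerSL ℂ (b i)).smulRight (T (b i))
  have hR : ∀ i x, R i x = inner ℂ (b i) x • T (b i) := fun i x => by simp [R]
  have hbound : ∀ t : Finset ι, ‖∑ i ∈ t, R i‖ ^ 2 ≤ ∑ i ∈ t, ‖T (b i)‖ ^ 2 := by
    intro t
    have h0 : 0 ≤ ∑ i ∈ t, ‖T (b i)‖ ^ 2 := Finset.sum_nonneg fun i _ => by positivity
    have : ‖∑ i ∈ t, R i‖ ≤ √(∑ i ∈ t, ‖T (b i)‖ ^ 2) := by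
      refine ContinuousLinearMap.opNorm_le_bound _ (Real.sqrt_nonneg _) fun x => ?_
      rw [sum_apply]
      calc ‖∑ i ∈ t, R i x‖ ≤ ∑ i ∈ t, ‖inner ℂ (b i) x‖ * ‖T (b i)‖ := by
            refine (norm_sum_le _ _).trans (Finset.sum_le_sum fun i _ => ?_)
            rw [hR, norm_smul]
        _ ≤ √(∑ i ∈ t, ‖inner ℂ (b i) x‖ ^ 2) * √(∑ i ∈ t, ‖T (b i)‖ ^ 2) :=
            Real.sum_mul_le_sqrt_mul_sqrt _ _ _
        _ ≤ ‖x‖ * √(∑ i ∈ t, ‖T (b i)‖ ^ 2) := by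
            gcongr
            exact Real.sqrt_le_iff.2 ⟨norm_nonneg _, b.orthonormal.sum_inner_products_le x⟩
        _ = _ := mul_comm _ _
    calc ‖∑ i ∈ t, R i‖ ^ 2 ≤ √(∑ i ∈ t, ‖T (b i)‖ ^ 2) ^ 2 := by gcongr
      _ = _ := Real.sq_sqrt h0
  have hsum : Summable R := by
    rw [summable_iff_vanishing_norm]
    intro ε hε
    obtain ⟨s, hs⟩ := summable_iff_vanishing_norm.1 hT (ε ^ 2) (by positivity)
    refine ⟨s, fun t ht => ?_⟩
    have h1 := (le_abs_self _).trans_lt (hs t ht)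
    exact lt_of_pow_lt_pow_left₀ 2 hε.le ((hbound t).trans_lt h1)
  have hTR : HasSum R T := by
    have h1 := hsum.hasSum
    have h2 : ∑' i, R i = T := by
      ext x
      have h3 : HasSum (fun i => R i x) ((∑' i, R i) x) :=
        h1.mapL (ContinuousLinearMap.apply ℂ H x)
      have h4 : HasSum (fun i => R i x) (T x) := by
        have h5 := (b.hasSum_repr x).mapL T
        simpa [hR, b.repr_apply_apply] using h5
      exact h3.unique h4
    rwa [h2] at h1
  have hcomp : ∀ t : Finset ι, IsCompactOperator (∑ i ∈ t, R i : H →L[ℂ] H) := by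
    intro t
    classical
    induction t using Finset.induction_on with
    | empty => simpa using isCompactOperator_zero
    | insert i t hi ih =>
      rw [Finset.sum_insert hi]
      refine IsCompactOperator.add ?_ ih
      have h1 : IsCompactOperator (innerSL ℂ (b i) : H →L[ℂ] ℂ) :=
        ((isCompactOperator_id_iff_finiteDimensional (𝕜 := ℂ) (E := ℂ)).2
          inferInstance).comp_clm (innerSL ℂ (b i))
      exact h1.clm_comp (ContinuousLinearMap.toSpanSingleton ℂ (T (b i)))
  exact isClosed_setOfPred_isCompactOperator.mem_of_tendsto hTR (Eventually.of_forall hcomp)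

end HilbertBasis

/-! ### Singular values and the Hilbert–Schmidt norm -/

section SingularValueSum

universe u

variable {H : Type u} [NormedAddCommGroup H] [InnerProductSpace ℂ H]

/-- An orthogonal family of complete subspaces whose sum is dense has a Hilbert basis
consisting of vectors of these subspaces. -/
theorem OrthogonalFamily.exists_hilbertBasis [CompleteSpace H] {κ : Type} {V : κ → Submodule ℂ H}
    [∀ k, CompleteSpace (V k)]
    (hV : OrthogonalFamily ℂ (fun k => V k) fun k => (V k).subtypeₗᵢ) (hbot : (⨆ k, V k)ᗮ = ⊥) :
    ∃ (ι : Type u) (b : HilbertBasis ι ℂ H) (l : ι → κ), ∀ i, b i ∈ V (l i) := by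
  choose w b hb using fun k => _root_.exists_hilbertBasis ℂ (V k)
  let e : (Σ k, w k) → H := fun a => (b a.1 a.2 : H)
  have hortho : Orthonormal ℂ e :=
    hV.orthonormal_sigma_orthonormal (v_family := fun k => b k) fun k => (b k).orthonormal
  have hbot' : (Submodule.span ℂ (Set.range e))ᗮ = ⊥ := by
    rw [Submodule.eq_bot_iff]
    intro x hx
    rw [Submodule.mem_orthogonal] at hx
    have h0 : ∀ (k : κ) (v : V k), inner ℂ (v : H) x = 0 := by
      intro k v
      have hd : v ∈ closure (Submodule.span ℂ (Set.range (b k)) : Set (V k)) := by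
        rw [← Submodule.topologicalClosure_coe, (b k).dense_span]
        trivial
      have hclosed : IsClosed {v : V k | inner ℂ (v : H) x = 0} :=
        isClosed_eq (by fun_prop) continuous_const
      refine closure_minimal (fun u hu => ?_) hclosed hd
      refine Submodule.span_induction (p := fun (u : V k) _ => inner ℂ (u : H) x = 0)
        ?_ ?_ ?_ ?_ hu
      · rintro _ ⟨i, rfl⟩
        exact hx (e ⟨k, i⟩) (Submodule.subset_span ⟨⟨k, i⟩, rfl⟩)
      · simp
      · intro u v _ _ hu hv
        rw [Submodule.coe_add, inner_add_left, hu, hv, add_zero]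
      · intro c u _ hu
        rw [Submodule.coe_smul, inner_smul_left, hu, mul_zero]
    have h1 : x ∈ (⨆ k, V k)ᗮ := by
      rw [← Submodule.iInf_orthogonal, Submodule.mem_iInf]
      intro k
      rw [Submodule.mem_orthogonal]
      exact fun v hv => h0 k ⟨v, hv⟩
    rwa [hbot, Submodule.mem_bot] at h1
  refine ⟨Σ k, w k, HilbertBasis.mkOfOrthogonalEqBot hortho hbot', Sigma.fst, fun a => ?_⟩
  rw [HilbertBasis.coe_mkOfOrthogonalEqBot]
  exact (b a.1 a.2).2

/-- A compact self-adjoint operator is diagonal in some Hilbert basis. -/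
theorem exists_hilbertBasis_eigenvectors [CompleteSpace H] {A : H →L[ℂ] H}
    (hA : IsCompactOperator A) (hs : A.IsSymmetric) :
    ∃ (ι : Type u) (b : HilbertBasis ι ℂ H) (l : ι → ℂ), ∀ i, A (b i) = l i • b i := by
  have : ∀ μ, CompleteSpace (Module.End.eigenspace A.toLinearMap μ) := by
    intro μ
    have h : (Module.End.eigenspace A.toLinearMap μ : Set H) = {x | A x = μ • x} := by
      ext x
      exact Module.End.mem_eigenspace_iff
    have hcl : IsClosed (Module.End.eigenspace A.toLinearMap μ : Set H) := by
      rw [h]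
      exact isClosed_eq A.continuous (continuous_const_smul μ)
    exact hcl.completeSpace_coe
  obtain ⟨ι, b, l, h⟩ := hs.orthogonalFamily_eigenspaces.exists_hilbertBasis
    (ContinuousLinearMap.orthogonalComplement_iSup_eigenspaces_eq_bot hA hs)
  exact ⟨ι, b, l, fun i => Module.End.mem_eigenspace_iff.1 (h i)⟩

variable [CompleteSpace H]

theorem norm_abs_apply (T : H →L[ℂ] H) (x : H) : ‖CFC.abs T x‖ = ‖T x‖ := by
  have hsa : ContinuousLinearMap.adjoint (CFC.abs T) = CFC.abs T :=
    (CFC.abs_nonneg T).isSelfAdjoint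
  have h : CFC.abs T (CFC.abs T x) = ContinuousLinearMap.adjoint T (T x) :=
    DFunLike.congr_fun (CFC.abs_mul_abs T) x
  have h2 : (‖CFC.abs T x‖ : ℂ) ^ 2 = (‖T x‖ : ℂ) ^ 2 := by
    have e1 := inner_self_eq_norm_sq_to_K (𝕜 := ℂ) (CFC.abs T x)
    have e2 := inner_self_eq_norm_sq_to_K (𝕜 := ℂ) (T x)
    rw [← ContinuousLinearMap.adjoint_inner_right, hsa, h,
      ContinuousLinearMap.adjoint_inner_right, e2] at e1
    exact e1.symm
  have h3 : ‖CFC.abs T x‖ ^ 2 = ‖T x‖ ^ 2 := by exact_mod_cast h2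
  exact (pow_left_inj₀ (norm_nonneg _) (norm_nonneg _) two_ne_zero).1 h3

open scoped ComplexOrder in
/-- For a compact operator `T`, the operator `√(T* T)` is diagonal in some Hilbert basis. -/
theorem exists_hilbertBasis_abs {T : H →L[ℂ] H} (hT : IsCompactOperator T) :
    ∃ (ι : Type u) (b : HilbertBasis ι ℂ H) (s : ι → ℝ),
      (∀ i, 0 ≤ s i) ∧ ∀ i, CFC.abs T (b i) = (s i : ℂ) • b i := by
  have hcomp : IsCompactOperator (ContinuousLinearMap.adjoint T ∘L T) :=
    hT.clm_comp (ContinuousLinearMap.adjoint T)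
  have hsymm : (ContinuousLinearMap.adjoint T ∘L T).IsSymmetric := by
    intro x y
    simp [ContinuousLinearMap.adjoint_inner_left, ContinuousLinearMap.adjoint_inner_right]
  obtain ⟨ι, b, l, hl⟩ := exists_hilbertBasis_eigenvectors hcomp hsymm
  have hpos : (CFC.abs T).IsPositive :=
    (ContinuousLinearMap.nonneg_iff_isPositive _).1 (CFC.abs_nonneg T)
  have hl2 : ∀ i, l i = ((‖T (b i)‖ ^ 2 : ℝ) : ℂ) := by
    intro i
    have h1 : inner ℂ (b i) ((ContinuousLinearMap.adjoint T ∘L T) (b i)) = l i := by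
      rw [hl, inner_smul_right, inner_self_eq_norm_sq_to_K, b.orthonormal.1 i]; simp
    rw [← h1, ContinuousLinearMap.comp_apply, ContinuousLinearMap.adjoint_inner_right,
      inner_self_eq_norm_sq_to_K]
    simp
  refine ⟨ι, b, fun i => ‖T (b i)‖, fun i => norm_nonneg _, fun i => ?_⟩
  beta_reduce
  rcases (norm_nonneg (T (b i))).eq_or_lt with h0 | h0
  · rw [← h0, Complex.ofReal_zero, zero_smul, ← norm_eq_zero, norm_abs_apply, ← h0]
  · set s : ℝ := ‖T (b i)‖ with hsdef
    -- The square of `|T|` acts on `b i` as `s²`, so `(|T| + s) u = 0`. Positivity of `|T|` then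
    -- gives `0 ≤ -s ‖u‖²`, which forces `u = 0` because `s > 0`.
    set u := CFC.abs T (b i) - (s : ℂ) • b i with hu
    have h : CFC.abs T (CFC.abs T (b i)) = ((s ^ 2 : ℝ) : ℂ) • b i := by
      have := DFunLike.congr_fun (CFC.abs_mul_abs T) (b i)
      exact this.trans ((hl i).trans (by rw [hl2 i]))
    have h1 : CFC.abs T u = -(s : ℂ) • u := by
      rw [hu, map_sub, map_smul, h, smul_sub, smul_smul]
      push_cast
      module
    have h2 := hpos.inner_nonneg_right u
    rw [h1, inner_smul_right, inner_self_eq_norm_sq_to_K] at h2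
    have h3 : (0 : ℂ) ≤ ((-s * ‖u‖ ^ 2 : ℝ) : ℂ) := by
      rw [Complex.ofReal_mul, Complex.ofReal_neg, Complex.ofReal_pow]; exact h2
    have h3' : 0 ≤ -s * ‖u‖ ^ 2 := Complex.zero_le_real.1 h3
    have h4 : ‖u‖ ^ 2 = 0 := by nlinarith [sq_nonneg ‖u‖]
    have h5 : u = 0 := by simpa using h4
    exact sub_eq_zero.1 h5

section Diagonal

variable {T : H →L[ℂ] H} {ι : Type u} {b : HilbertBasis ι ℂ H} {s : ι → ℝ}

/-- By self-adjointness an eigenvector for `r > t` is orthogonal to each `b i` with `s i ≤ t`; if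
only finitely many `s i` exceed `t`, the corresponding `b i` therefore span the subspace. Conversely
these `b i` are independent vectors in it. Since `j` is finite, nothing is lost in passing from
cardinals to `ℕ∞`. -/
theorem rank_spectralSubspace_le_iff (hs : ∀ i, CFC.abs T (b i) = (s i : ℂ) • b i) (t : ℝ)
    (j : ℕ) : Module.rank ℂ (spectralSubspace T t) ≤ j ↔ {i | t < s i}.encard ≤ j := by
  have hcard : {i | t < s i}.encard ≤ j ↔ Cardinal.mk {i | t < s i} ≤ j :=
    Cardinal.toENat_le_natCast
  rw [hcard]
  constructor
  · intro h
    have hmem : ∀ i : {i | t < s i}, b i ∈ spectralSubspace T t := fun i =>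
      Submodule.mem_iSup_of_mem (s i) (Submodule.mem_iSup_of_mem i.2
        (Module.End.mem_eigenspace_iff.2 (hs i)))
    have hli : LinearIndependent ℂ fun i : {i | t < s i} =>
        (⟨b i, hmem i⟩ : spectralSubspace T t) := by
      apply LinearIndependent.of_comp (spectralSubspace T t).subtype
      exact b.orthonormal.linearIndependent.comp _ Subtype.val_injective
    exact hli.cardinal_le_rank.trans h
  · intro h
    have hfin : {i | t < s i}.Finite :=
      Cardinal.lt_aleph0_iff_set_finite.1 (h.trans_lt Cardinal.natCast_lt_aleph0)
    have hsub : spectralSubspace T t ≤ Submodule.span ℂ (b '' {i | t < s i}) := by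
      refine iSup₂_le fun r hr v hv => ?_
      have hv' : CFC.abs T v = (r : ℂ) • v := Module.End.mem_eigenspace_iff.1 hv
      have hsa : ContinuousLinearMap.adjoint (CFC.abs T) = CFC.abs T :=
        (CFC.abs_nonneg T).isSelfAdjoint
      have hzero : ∀ i, i ∉ {i | t < s i} → b.repr v i • b i = 0 := by
        intro i hi
        have h1 : (s i : ℂ) * inner ℂ (b i) v = r * inner ℂ (b i) v := by
          have h2 := ContinuousLinearMap.adjoint_inner_left (CFC.abs T) v (b i)
          rw [hsa, hs, hv', inner_smul_left, inner_smul_right, Complex.conj_ofReal] at h2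
          exact h2
        have h3 : (s i : ℂ) ≠ r := by
          intro h
          rw [Complex.ofReal_inj] at h
          rw [Set.mem_ofPred_eq, h] at hi
          exact hi hr
        rw [b.repr_apply_apply]
        rcases mul_eq_mul_right_iff.1 h1 with h | h
        · exact absurd h h3
        · rw [h, zero_smul]
      have hsum := b.hasSum_repr v
      have hsum2 : HasSum (fun i => b.repr v i • b i) (∑ i ∈ hfin.toFinset, b.repr v i • b i) :=
        hasSum_sum_of_ne_finset_zero fun i hi => hzero i (by simpa using hi)
      rw [hsum.unique hsum2]
      refine Submodule.sum_mem _ fun i hi => Submodule.smul_mem _ _ (Submodule.subset_span ?_)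
      exact ⟨i, by simpa using hi, rfl⟩
    calc Module.rank ℂ (spectralSubspace T t)
        ≤ Module.rank ℂ (Submodule.span ℂ (b '' {i | t < s i})) := Submodule.rank_mono hsub
      _ ≤ Cardinal.mk (b '' {i | t < s i}) := rank_span_le _
      _ ≤ Cardinal.mk {i | t < s i} := Cardinal.mk_image_le
      _ ≤ j := h

/-- The strict inequality needs room above `t`: among `j + 1` indices with `t < s i`, the smallest
value `s i₀` is a lower bound of the set whose infimum is taken, since below `s i₀` all `j + 1`
values still count. -/
theorem lt_singularValue_iff (hs : ∀ i, CFC.abs T (b i) = (s i : ℂ) • b i) {t : ℝ} (ht : 0 ≤ t)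
    (j : ℕ) : t < singularValue T j ↔ (j : ℕ∞) < {i | t < s i}.encard := by
  have hle : ∀ i, s i ≤ ‖CFC.abs T‖ := by
    intro i
    have h1 := (CFC.abs T).le_opNorm (b i)
    rw [hs, norm_smul, b.orthonormal.1 i, mul_one, mul_one, Complex.norm_real] at h1
    exact (le_abs_self _).trans h1
  simp only [singularValue, rank_spectralSubspace_le_iff hs]
  have hne : {t : ℝ | 0 ≤ t ∧ {i | t < s i}.encard ≤ j}.Nonempty := by
    refine ⟨‖CFC.abs T‖, norm_nonneg _, ?_⟩
    have : {i | ‖CFC.abs T‖ < s i} = ∅ := by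
      ext i; simpa using hle i
    rw [this]; simp
  have hbdd : BddBelow {t : ℝ | 0 ≤ t ∧ {i | t < s i}.encard ≤ j} := ⟨0, fun t h => h.1⟩
  constructor
  · intro h
    by_contra hcon
    exact h.not_ge (csInf_le hbdd ⟨ht, not_lt.1 hcon⟩)
  · intro h
    obtain ⟨F, hF, hFc⟩ := Set.exists_subset_encard_eq (Order.add_one_le_of_lt h)
    have hFfin : F.Finite := by
      rw [← Set.encard_lt_top_iff, hFc]
      exact_mod_cast ENat.natCast_lt_top (j + 1)
    have hFne : F.Nonempty := by
      rw [← Set.encard_pos, hFc]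
      exact_mod_cast Nat.succ_pos j
    obtain ⟨i₀, hi₀, hmin⟩ := hFfin.exists_minimalFor s F hFne
    have hlt : t < s i₀ := hF hi₀
    refine hlt.trans_le (le_csInf hne ?_)
    rintro r ⟨hr0, hr⟩
    by_contra! hcon
    have hsub : F ⊆ {i | r < s i} := by
      intro i hi
      rcases le_total (s i) (s i₀) with h2 | h2
      · exact hcon.trans_le (hmin hi h2)
      · exact hcon.trans_le h2
    have h3 := (Set.encard_le_encard hsub).trans hr
    rw [hFc] at h3
    have h4 : ((j + 1 : ℕ) : ℕ∞) ≤ j := by exact_mod_cast h3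
    exact absurd (Nat.cast_le.1 h4) (by omega)

end Diagonal

theorem ENat.encard_setOf_natCast_lt (n : ℕ∞) : {j : ℕ | (j : ℕ∞) < n}.encard = n := by
  induction n using ENat.recTopCoe with
  | top =>
    have : {j : ℕ | (j : ℕ∞) < ⊤} = Set.univ := by ext j; simp
    rw [this, Set.encard_univ]
    simp
  | coe n =>
    have : {j : ℕ | (j : ℕ∞) < n} = (Finset.range n : Set ℕ) := by ext j; simp
    rw [this, Set.encard_coe_eq_coe_finsetCard, Finset.card_range]

/-- Layer cake formula for a sum of squares. -/
theorem tsum_ofReal_sq_eq_lintegral {α : Type*} {f : α → ℝ} (hf : ∀ a, 0 ≤ f a) :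
    ∑' a, ENNReal.ofReal (f a ^ 2)
      = ∫⁻ t in Set.Ioi (0 : ℝ), ({a | t < f a}.encard : ℝ≥0∞) * ENNReal.ofReal (2 * t) := by
  let _ : MeasurableSpace α := ⊤
  have h := lintegral_comp_eq_lintegral_meas_lt_mul (f := f) (g := fun t => 2 * t) Measure.count
    (Eventually.of_forall hf) (measurable_from_top.aemeasurable)
    (fun t _ => (by fun_prop : Continuous fun t : ℝ => 2 * t).intervalIntegrable _ _)
    (by filter_upwards [ae_restrict_mem measurableSet_Ioi] with t ht
        have : 0 < t := ht
        positivity)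
  rw [lintegral_count] at h
  have h2 : ∀ x : ℝ, ∫ t in (0 : ℝ)..x, 2 * t = x ^ 2 := by
    intro x
    rw [intervalIntegral.integral_const_mul, integral_id]
    ring
  simp only [h2] at h
  rw [h]
  refine lintegral_congr fun t => ?_
  rw [Measure.count_apply MeasurableSpace.measurableSet_top]

theorem singularValue_nonneg (T : H →L[ℂ] H) (j : ℕ) : 0 ≤ singularValue T j :=
  Real.sInf_nonneg fun _ h => h.1

/-- The sum of the squares of the singular values is the square of the Hilbert–Schmidt norm. -/
theorem tsum_singularValue_sq {T : H →L[ℂ] H} (hT : IsCompactOperator T) {κ : Type*}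
    (c : HilbertBasis κ ℂ H) :
    ∑' j, ENNReal.ofReal (singularValue T j ^ 2) = ∑' k, ‖T (c k)‖ₑ ^ 2 := by
  obtain ⟨ι, b, s, hs0, hs⟩ := exists_hilbertBasis_abs hT
  rw [c.tsum_enorm_sq_eq b T]
  have h1 : ∀ i, ‖T (b i)‖ₑ ^ 2 = ENNReal.ofReal (s i ^ 2) := by
    intro i
    have h2 : ‖T (b i)‖ = s i := by
      rw [← norm_abs_apply, hs, norm_smul, b.orthonormal.1 i, mul_one, Complex.norm_real,
        Real.norm_of_nonneg (hs0 i)]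
    rw [ENNReal.ofReal_pow (hs0 i), ← h2, ofReal_norm]
  simp_rw [h1]
  -- The families `s` and `singularValue T` are never matched by a bijection; it is enough that for
  -- each `t > 0` equally many members of each exceed `t`, because the layer cake formula sees only
  -- these counts.
  rw [tsum_ofReal_sq_eq_lintegral hs0, tsum_ofReal_sq_eq_lintegral (singularValue_nonneg T)]
  refine setLIntegral_congr_fun measurableSet_Ioi fun t ht => ?_
  have h2 : {j : ℕ | t < singularValue T j} = {j : ℕ | (j : ℕ∞) < {i | t < s i}.encard} := by
    ext j
    exact lt_singularValue_iff hs (le_of_lt ht) j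
  simp only [h2, ENat.encard_setOf_natCast_lt]

/-- An operator with square summable values on a Hilbert basis is compact, its singular values
are square summable and the sum of their squares is that of the values on the basis. -/
theorem hasSum_singularValue_sq {T : H →L[ℂ] H} {κ : Type*} (c : HilbertBasis κ ℂ H) {a : ℝ}
    (ha : 0 ≤ a) (hT : ∑' k, ‖T (c k)‖ₑ ^ 2 = ENNReal.ofReal a) :
    IsCompactOperator T ∧ HasSum (fun j => singularValue T j ^ 2) a := by
  have h1 : ∀ k, ‖T (c k)‖ₑ ^ 2 = ENNReal.ofReal (‖T (c k)‖ ^ 2) := fun k => by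
    rw [ENNReal.ofReal_pow (norm_nonneg _), ofReal_norm]
  have hsum : Summable fun k => ‖T (c k)‖ ^ 2 := by
    have h2 : ∑' k, ENNReal.ofReal (‖T (c k)‖ ^ 2) ≠ ∞ := by
      simp_rw [← h1, hT]
      exact ENNReal.ofReal_ne_top
    have h3 := ENNReal.summable_toReal h2
    simpa [ENNReal.toReal_ofReal, sq_nonneg] using h3
  have hcomp := c.isCompactOperator_of_summable T hsum
  refine ⟨hcomp, ?_⟩
  have h2 := tsum_singularValue_sq hcomp c
  rw [hT] at h2
  have h3 : ∀ j, ENNReal.toReal (ENNReal.ofReal (singularValue T j ^ 2)) = singularValue T j ^ 2 :=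
    fun j => ENNReal.toReal_ofReal (sq_nonneg _)
  have h4 := ENNReal.hasSum_toReal (f := fun j => ENNReal.ofReal (singularValue T j ^ 2))
    (by rw [h2]; exact ENNReal.ofReal_ne_top)
  simp only [h3] at h4
  rw [← tsum_congr h3, ← ENNReal.tsum_toReal_eq (fun j => ENNReal.ofReal_ne_top), h2,
    ENNReal.toReal_ofReal ha] at h4
  exact h4

end SingularValueSum

noncomputable section

/-! ### The Hilbert–Schmidt norm of the transfer operators -/

namespace Bergman

section Vector

variable {Ω : Opens ℂ} {E : Type*} [NormedAddCommGroup E] [InnerProductSpace ℂ E]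

/-- The inner product of the Bergman space, found ahead of the one of `ℂ`-valued C⋆-modules. -/
instance instInner : Inner ℂ (BergmanSpace Ω E) := InnerProductSpace.toInner

theorem ae_eq_extend [CompleteSpace E] (f : BergmanSpace Ω E) :
    (f : Lp E 2 (volume.restrict (Ω : Set ℂ))) =ᵐ[volume.restrict (Ω : Set ℂ)] extend f := by
  filter_upwards [rep_ae_eq f, ae_restrict_mem Ω.isOpen.measurableSet] with z h hz
  rw [h, extend_eqOn f hz]

variable [CompleteSpace E]

theorem extend_apply (f : BergmanSpace Ω E) (z : Ω) : extend f z = f z := by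
  simp [extend]

theorem extend_differentiableOn (f : BergmanSpace Ω E) : DifferentiableOn ℂ (extend f) Ω :=
  (rep_differentiableOn f).congr (extend_eqOn f)

theorem inner_eq_integral (f g : BergmanSpace Ω E) :
    inner ℂ f g = ∫ z in (Ω : Set ℂ), inner ℂ (extend f z) (extend g z) := by
  rw [Submodule.coe_inner, L2.inner_def]
  refine integral_congr_ae ?_
  filter_upwards [ae_eq_extend f, ae_eq_extend g] with z h1 h2
  rw [h1, h2]

theorem enorm_sq_eq_lintegral (f : BergmanSpace Ω E) :
    ‖f‖ₑ ^ 2 = ∫⁻ z in (Ω : Set ℂ), ‖extend f z‖ₑ ^ 2 := by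
  have h1 : ‖f‖ₑ = eLpNorm (extend f) 2 (volume.restrict (Ω : Set ℂ)) := by
    rw [← eLpNorm_congr_ae (ae_eq_extend f)]
    exact Lp.enorm_def f.1
  rw [h1, eLpNorm_eq_lintegral_rpow_enorm_toReal (by norm_num) (by norm_num), ← ENNReal.rpow_natCast,
    ← ENNReal.rpow_mul]
  simp

theorem exists_inner_apply (f : BergmanSpace Ω E) (w : E) :
    ∃ g : BergmanSpace Ω ℂ, ∀ z : Ω, g z = inner ℂ w (f z) := by
  obtain ⟨g, hg⟩ := exists_of_holomorphic
    (F := fun z => innerSL ℂ w (rep f z))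
    ((innerSL ℂ w).differentiable.comp_differentiableOn (rep_differentiableOn f))
    ((innerSL ℂ w).comp_memLp' (rep_memLp f))
  exact ⟨g, fun z => by rw [hg]; rfl⟩

theorem exists_smul_const (g : BergmanSpace Ω ℂ) (w : E) :
    ∃ f : BergmanSpace Ω E, ∀ z : Ω, f z = g z • w := by
  obtain ⟨f, hf⟩ := exists_of_holomorphic
    (F := fun z => (ContinuousLinearMap.toSpanSingleton ℂ w) (rep g z))
    ((ContinuousLinearMap.toSpanSingleton ℂ w).differentiable.comp_differentiableOn
      (rep_differentiableOn g))
    ((ContinuousLinearMap.toSpanSingleton ℂ w).comp_memLp' (rep_memLp g))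
  exact ⟨f, fun z => by rw [hf]; rfl⟩

/-- The vector-valued kernel is the scalar one times the identity: the pairing of `f` with a fixed
`w` is a scalar Bergman function, and the scalar reproducing property applies to it. -/
theorem kerFun_apply_eq_smul (x z : Ω) (w : E) :
    RKHS.kerFun (BergmanSpace Ω E) x w z = RKHS.kerFun (BergmanSpace Ω ℂ) x 1 z • w := by
  obtain ⟨k, hk⟩ := exists_smul_const (RKHS.kerFun (BergmanSpace Ω ℂ) x 1) w
  have : RKHS.kerFun (BergmanSpace Ω E) x w = k := by
    refine ext_inner_right ℂ fun f => ?_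
    obtain ⟨g, hg⟩ := exists_inner_apply f w
    have h1 : inner ℂ (RKHS.kerFun (BergmanSpace Ω ℂ) x 1) g = g x := by simp
    rw [RKHS.kerFun_inner, ← hg, ← h1, inner_eq_integral, inner_eq_integral]
    refine setIntegral_congr_fun Ω.isOpen.measurableSet fun z hz => ?_
    have e1 := extend_apply f ⟨z, hz⟩
    have e2 := extend_apply k ⟨z, hz⟩
    have e3 := extend_apply g ⟨z, hz⟩
    have e4 := extend_apply (RKHS.kerFun (BergmanSpace Ω ℂ) x 1) ⟨z, hz⟩
    dsimp only at e1 e2 e3 e4 ⊢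
    rw [e1, e2, e3, e4, hk, hg, inner_smul_left, RCLike.inner_apply, mul_comm]
  rw [this, hk]

theorem inner_kerFun_kerFun (x y : Ω) (v w : E) :
    inner ℂ (RKHS.kerFun (BergmanSpace Ω E) x v) (RKHS.kerFun (BergmanSpace Ω E) y w)
      = kernel Ω x y * inner ℂ v w := by
  rw [RKHS.kerFun_inner, kerFun_apply_eq_smul, inner_smul_right, kernel, dif_pos ⟨x.2, y.2⟩,
    RKHS.kerFun_apply]

end Vector

variable {Ω : Opens ℂ}

theorem kernel_eq_inner (x y : Ω) :
    kernel Ω x y = inner ℂ (RKHS.kerFun (BergmanSpace Ω ℂ) x 1)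
      (RKHS.kerFun (BergmanSpace Ω ℂ) y 1) := by
  rw [inner_kerFun_kerFun]; simp

theorem conj_kernel (x y : Ω) : starRingEnd ℂ (kernel Ω x y) = kernel Ω y x := by
  rw [kernel_eq_inner, kernel_eq_inner, inner_conj_symm]

theorem kernel_self (x : Ω) :
    kernel Ω x x = ((‖RKHS.kerFun (BergmanSpace Ω ℂ) x 1‖ ^ 2 : ℝ) : ℂ) := by
  rw [kernel_eq_inner, inner_self_eq_norm_sq_to_K]; simp

/-- Finite area puts the constant 1 in the Bergman space, and the kernel vector pairs with it to 1.
-/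
theorem kerFun_ne_zero (hfin : volume (Ω : Set ℂ) ≠ ∞) (x : Ω) :
    RKHS.kerFun (BergmanSpace Ω ℂ) x 1 ≠ 0 := by
  intro h
  obtain ⟨f, hf⟩ := exists_of_holomorphic (Ω := Ω) (F := fun _ => (1 : ℂ))
    (differentiableOn_const _)
    (memLp_of_bound hfin (differentiableOn_const _) (C := 1) (fun z _ => by simp))
  have h1 : inner ℂ (RKHS.kerFun (BergmanSpace Ω ℂ) x 1) f = f x := by simp
  rw [h, inner_zero_left, hf] at h1
  exact zero_ne_one h1

/-- Evaluating a kernel vector `k` at its own point gives `‖k‖² ≤ C ‖k‖`, hence `‖k‖ ≤ C`, where `C`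
bounds evaluation on `K`. Cauchy–Schwarz handles two different points. -/
theorem exists_norm_kernel_le {K : Set ℂ} (hK : IsCompact K) (hKΩ : K ⊆ Ω) :
    ∃ C : ℝ, ∀ x ∈ K, ∀ y ∈ K, ‖kernel Ω x y‖ ≤ C := by
  obtain ⟨C, hC, h⟩ := exists_norm_rep_le (E := ℂ) hK hKΩ
  have hk : ∀ x (hx : x ∈ K), ‖RKHS.kerFun (BergmanSpace Ω ℂ) ⟨x, hKΩ hx⟩ 1‖ ≤ C := by
    intro x hx
    set k := RKHS.kerFun (BergmanSpace Ω ℂ) ⟨x, hKΩ hx⟩ 1 with hkdef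
    have h1 : inner ℂ k k = k ⟨x, hKΩ hx⟩ := by
      rw [hkdef, RKHS.kerFun_inner]; simp
    have h2 : ‖k‖ ^ 2 ≤ C * ‖k‖ := by
      have h3 := h k x hx
      rw [← apply_eq_rep k ⟨x, hKΩ hx⟩, ← h1, inner_self_eq_norm_sq_to_K] at h3
      simpa using h3
    rcases (norm_nonneg k).eq_or_lt with h0 | h0
    · rw [← h0]; exact hC
    · nlinarith
  refine ⟨C * C, fun x hx y hy => ?_⟩
  rw [show kernel Ω x y = _ from kernel_eq_inner ⟨x, hKΩ hx⟩ ⟨y, hKΩ hy⟩]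
  refine (norm_inner_le_norm _ _).trans ?_
  gcongr
  · exact hk x hx
  · exact hk y hy

instance {E : Type*} [NormedAddCommGroup E] [InnerProductSpace ℂ E] [SeparableSpace E] :
    SeparableSpace (BergmanSpace Ω E) :=
  have : Fact ((2 : ℝ≥0∞) ≠ ∞) := ⟨by norm_num⟩
  have : SecondCountableTopology (Lp E 2 (volume.restrict (Ω : Set ℂ))) := inferInstance
  inferInstance

/-- Parseval expands the kernel as `∑ b_i(φ z) conj (b_i(ψ z))`, a pointwise limit of continuous
partial sums; separability makes the index set countable. -/
theorem aestronglyMeasurable_kernel_comp {φ ψ : ℂ → ℂ} (hφ : ContinuousOn φ Ω)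
    (hψ : ContinuousOn ψ Ω) (hφΩ : Set.MapsTo φ Ω Ω) (hψΩ : Set.MapsTo ψ Ω Ω) :
    AEStronglyMeasurable (fun z => kernel Ω (φ z) (ψ z)) (volume.restrict (Ω : Set ℂ)) := by
  obtain ⟨w, b, -⟩ := exists_hilbertBasis ℂ (BergmanSpace Ω ℂ)
  have := b.countable_index
  refine aestronglyMeasurable_of_tendsto_ae (ι := Finset w) atTop
    (f := fun s z => ∑ i ∈ s, extend (b i) (φ z) * starRingEnd ℂ (extend (b i) (ψ z))) ?_ ?_
  · intro s
    refine ContinuousOn.aestronglyMeasurable ?_ Ω.isOpen.measurableSet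
    refine continuousOn_finsetSum _ fun i _ => ContinuousOn.mul ?_ ?_
    · exact (extend_differentiableOn (b i)).continuousOn.comp hφ hφΩ
    · exact Complex.continuous_conj.comp_continuousOn
        ((extend_differentiableOn (b i)).continuousOn.comp hψ hψΩ)
  · filter_upwards [ae_restrict_mem Ω.isOpen.measurableSet] with z hz
    have h := b.hasSum_inner_mul_inner (RKHS.kerFun (BergmanSpace Ω ℂ) ⟨φ z, hφΩ hz⟩ 1)
      (RKHS.kerFun (BergmanSpace Ω ℂ) ⟨ψ z, hψΩ hz⟩ 1)
    rw [← kernel_eq_inner] at h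
    have h2 : ∀ i, inner ℂ (RKHS.kerFun (BergmanSpace Ω ℂ) ⟨φ z, hφΩ hz⟩ 1) (b i) *
        inner ℂ (b i) (RKHS.kerFun (BergmanSpace Ω ℂ) ⟨ψ z, hψΩ hz⟩ 1)
        = extend (b i) (φ z) * starRingEnd ℂ (extend (b i) (ψ z)) := by
      intro i
      rw [← inner_conj_symm (b i), RKHS.kerFun_inner, RKHS.kerFun_inner,
        ← extend_apply (b i) ⟨φ z, hφΩ hz⟩, ← extend_apply (b i) ⟨ψ z, hψΩ hz⟩]
      simp
    simp only [h2] at h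
    exact h

end Bergman

/-- The number of points where the `i`-th and the `j`-th permutation agree. -/
def agreement {d N : ℕ} (σ : Fin d → Equiv.Perm (Fin N)) (i j : Fin d) : ℕ :=
  (Finset.univ.filter fun v => σ i v = σ j v).card

/-! ### Reduction of the Hilbert–Schmidt norm to agreement numbers -/

namespace ContractionSystem

variable {d : ℕ} (S : ContractionSystem d)

theorem volume_ne_top : volume (S.Ω : Set ℂ) ≠ ∞ := S.isBounded.measure_lt_top.ne

theorem coe_map (j : Fin d) (z : S.Ω) : (S.map j z : ℂ) = S.γ j z := rfl

/-- The images of the `γ_j` have compact closure in `Ω`, on which the weights and the kernel are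
bounded, and `Ω` has finite area. -/
theorem integrableOn_bergmanIntegrand (i j : Fin d) :
    IntegrableOn (S.bergmanIntegrand i j) (S.Ω : Set ℂ) := by
  have hK : ∀ j, IsCompact (closure (S.γ j '' (S.Ω : Set ℂ))) := fun j =>
    (S.isBounded.subset (S.mapsTo_γ j).image_subset).isCompact_closure
  have hexp : ∀ j, ContinuousOn (fun z => Complex.exp (S.G (S.γ j z))) S.Ω := fun j =>
    ((S.differentiableOn_G.comp (S.differentiableOn_γ j) (S.mapsTo_γ j)).cexp).continuousOn
  have hexpb : ∀ j, ∃ M, ∀ z ∈ S.Ω, ‖Complex.exp (S.G (S.γ j z))‖ ≤ M := by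
    intro j
    obtain ⟨M, hM⟩ := (hK j).exists_bound_of_continuousOn
      (Complex.continuous_exp.comp_continuousOn
        (S.differentiableOn_G.continuousOn.mono (S.closure_image_subset j)))
    exact ⟨M, fun z hz => hM _ (subset_closure (Set.mem_image_of_mem _ hz))⟩
  obtain ⟨M₁, hM₁⟩ := hexpb i
  obtain ⟨M₂, hM₂⟩ := hexpb j
  obtain ⟨C, hC⟩ := Bergman.exists_norm_kernel_le ((hK i).union (hK j))
    (Set.union_subset (S.closure_image_subset i) (S.closure_image_subset j))
  have hexpc : ∀ z, Complex.exp (starRingEnd ℂ (S.G (S.γ j z)))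
      = starRingEnd ℂ (Complex.exp (S.G (S.γ j z))) := fun z => Complex.exp_conj _
  have : IsFiniteMeasure (volume.restrict (S.Ω : Set ℂ)) :=
    isFiniteMeasure_restrict.2 S.volume_ne_top
  refine Integrable.of_bound (C := M₁ * M₂ * C) ?_ ?_
  · refine AEStronglyMeasurable.mul (ContinuousOn.aestronglyMeasurable ?_
      S.Ω.isOpen.measurableSet) (Bergman.aestronglyMeasurable_kernel_comp
        (S.differentiableOn_γ i).continuousOn (S.differentiableOn_γ j).continuousOn
        (S.mapsTo_γ i) (S.mapsTo_γ j))
    simp only [hexpc]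
    exact (hexp i).mul (Complex.continuous_conj.comp_continuousOn (hexp j))
  · filter_upwards [ae_restrict_mem S.Ω.isOpen.measurableSet] with z hz
    rw [bergmanIntegrand, norm_mul, norm_mul, hexpc, RCLike.norm_conj]
    have h1 := hM₁ z hz
    have h2 := hM₂ z hz
    have h3 := hC (S.γ i z) (Or.inl (subset_closure (Set.mem_image_of_mem _ hz)))
      (S.γ j z) (Or.inr (subset_closure (Set.mem_image_of_mem _ hz)))
    have := (norm_nonneg _).trans h1
    have := (norm_nonneg _).trans h2
    gcongr

theorem conj_bergmanIntegral (i j : Fin d) :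
    starRingEnd ℂ (S.bergmanIntegral i j) = S.bergmanIntegral j i := by
  rw [bergmanIntegral, bergmanIntegral, ← integral_conj]
  refine setIntegral_congr_fun S.Ω.isOpen.measurableSet fun z hz => ?_
  have h := Bergman.conj_kernel (S.map i ⟨z, hz⟩) (S.map j ⟨z, hz⟩)
  simp only [coe_map] at h
  simp only [bergmanIntegrand, map_mul, ← Complex.exp_conj, Complex.conj_conj, h]
  ring

theorem bergmanIntegrand_self (j : Fin d) (z : S.Ω) :
    S.bergmanIntegrand j j z = ((‖Complex.exp (S.G (S.γ j z))‖ ^ 2 *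
      ‖RKHS.kerFun (BergmanSpace S.Ω ℂ) (S.map j z) 1‖ ^ 2 : ℝ) : ℂ) := by
  have h := Bergman.kernel_self (S.map j z)
  rw [coe_map] at h
  rw [bergmanIntegrand, h, Complex.exp_conj, Complex.mul_conj, Complex.normSq_eq_norm_sq]
  push_cast
  ring

theorem bergmanIntegral_self_eq (j : Fin d) :
    S.bergmanIntegral j j = ∫ z in (S.Ω : Set ℂ),
      (‖Complex.exp (S.G (S.γ j z))‖ ^ 2 : ℝ) * Bergman.kernel S.Ω (S.γ j z) (S.γ j z) := by
  refine setIntegral_congr_fun S.Ω.isOpen.measurableSet fun z hz => ?_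
  simp only [bergmanIntegrand]
  rw [Complex.exp_conj, Complex.mul_conj, Complex.normSq_eq_norm_sq]

theorem bergmanIntegral_self_re_pos (j : Fin d) : 0 < (S.bergmanIntegral j j).re := by
  have hint := S.integrableOn_bergmanIntegrand j j
  have h1 : (S.bergmanIntegral j j).re = ∫ z in (S.Ω : Set ℂ), (S.bergmanIntegrand j j z).re :=
    (integral_re hint).symm
  have hpos : ∀ z ∈ (S.Ω : Set ℂ), 0 < (S.bergmanIntegrand j j z).re := by
    intro z hz
    rw [S.bergmanIntegrand_self j ⟨z, hz⟩, Complex.ofReal_re]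
    have h2 := norm_pos_iff.2 (Bergman.kerFun_ne_zero S.volume_ne_top (S.map j ⟨z, hz⟩))
    have h3 := norm_pos_iff.2 (Complex.exp_ne_zero (S.G (S.γ j z)))
    positivity
  have hre : IntegrableOn (fun z => (S.bergmanIntegrand j j z).re) (S.Ω : Set ℂ) volume := hint.re
  rw [h1, setIntegral_pos_iff_support_of_nonneg_ae _ hre]
  · have : (Function.support fun z => (S.bergmanIntegrand j j z).re) ∩ (S.Ω : Set ℂ) = S.Ω :=
      Set.inter_eq_right.2 fun z hz => (hpos z hz).ne'
    rw [this]
    exact S.Ω.isOpen.measure_pos _ S.isSimplyConnected.nonempty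
  · filter_upwards [ae_restrict_mem S.Ω.isOpen.measurableSet] with z hz using (hpos z hz).le

variable {N : ℕ} (σ : Fin d → Equiv.Perm (Fin N))

/-- The vector that represents the linear form `F ↦ (L F)(z)_v`. -/
def transferFunctional (z : S.Ω) (v : Fin N) : S.HilbertSpace N :=
  ∑ j, starRingEnd ℂ (Complex.exp (S.G (S.map j z))) •
    RKHS.kerFun (S.HilbertSpace N) (S.map j z) (EuclideanSpace.single (σ j v) 1)

theorem inner_transferFunctional (z : S.Ω) (v : Fin N) (F : S.HilbertSpace N) :
    inner ℂ (S.transferFunctional σ z v) F = S.transferOperator N σ F z v := by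
  rw [transferOperator_apply, transferFunctional, sum_inner]
  simp only [WithLp.ofLp_sum, Finset.sum_apply, WithLp.ofLp_smul, Pi.smul_apply]
  refine Finset.sum_congr rfl fun j _ => ?_
  refine (inner_smul_left (𝕜 := ℂ) (E := S.HilbertSpace N) _ _ _).trans ?_
  rw [Complex.conj_conj, RKHS.kerFun_inner, smul_eq_mul]
  congr 1
  rw [EuclideanSpace.inner_single_left]
  -- The permutation matrix acts by `x ↦ x ∘ σ_j`, so coordinate `v` of the image is coordinate `σ_j
  -- v` of the vector. This is why `transferFunctional` uses the direction `σ j v` rather than its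
  -- inverse image.
  rw [Matrix.ofLp_toEuclideanCLM, Matrix.permMatrix_mulVec]
  simp

/-- The kernels at `γ_i z` and `γ_j z` point in the coordinate directions `σ_i v` and `σ_j v`, which
are orthogonal unless they coincide; only then does the scalar kernel survive. -/
theorem inner_transferFunctional_self (z : S.Ω) (v : Fin N) :
    inner ℂ (S.transferFunctional σ z v) (S.transferFunctional σ z v)
      = ∑ i, ∑ j, if σ i v = σ j v then S.bergmanIntegrand i j z else 0 := by
  rw [transferFunctional, sum_inner]
  refine Finset.sum_congr rfl fun i _ => ?_
  rw [inner_sum]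
  refine Finset.sum_congr rfl fun j _ => ?_
  refine (inner_smul_left (𝕜 := ℂ) (E := S.HilbertSpace N) _ _ _).trans ?_
  refine (congrArg _ (inner_smul_right (𝕜 := ℂ) (E := S.HilbertSpace N) _ _ _)).trans ?_
  rw [Complex.conj_conj, Bergman.inner_kerFun_kerFun,
    EuclideanSpace.inner_single_left, bergmanIntegrand, Complex.exp_conj]
  simp only [coe_map, map_one, one_mul, PiLp.single_apply]
  split_ifs <;> ring

/-- Summing the indicators of `σ_i v = σ_j v` over `v` produces the agreement numbers. Real parts
may be taken since the total is a sum of squared norms, which also gives the nonnegativity. -/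
theorem sum_enorm_transferFunctional_sq (z : S.Ω) :
    ∑ v, ‖S.transferFunctional σ z v‖ₑ ^ 2
      = ENNReal.ofReal (∑ i, ∑ j, (agreement σ i j : ℝ) * (S.bergmanIntegrand i j z).re) ∧
    0 ≤ ∑ i, ∑ j, (agreement σ i j : ℝ) * (S.bergmanIntegrand i j z).re := by
  have h1 : ∀ v, ‖S.transferFunctional σ z v‖ ^ 2
      = ∑ i, ∑ j, if σ i v = σ j v then (S.bergmanIntegrand i j z).re else 0 := by
    intro v
    have h2 := congrArg Complex.re (S.inner_transferFunctional_self σ z v)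
    rw [inner_self_eq_norm_sq_to_K] at h2
    have h3 : ((‖S.transferFunctional σ z v‖ : ℂ) ^ 2).re = ‖S.transferFunctional σ z v‖ ^ 2 := by
      rw [← Complex.ofReal_pow, Complex.ofReal_re]
    rw [← h3]
    refine h2.trans ?_
    simp only [Complex.re_sum, apply_ite Complex.re, Complex.zero_re]
  have h4 : ∑ i, ∑ j, (agreement σ i j : ℝ) * (S.bergmanIntegrand i j z).re
      = ∑ v, ‖S.transferFunctional σ z v‖ ^ 2 := by
    simp_rw [h1]
    conv_rhs => rw [Finset.sum_comm]
    refine Finset.sum_congr rfl fun i _ => ?_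
    conv_rhs => rw [Finset.sum_comm]
    refine Finset.sum_congr rfl fun j _ => ?_
    rw [← Finset.sum_filter, Finset.sum_const, nsmul_eq_mul, agreement]
  rw [h4]
  refine ⟨?_, Finset.sum_nonneg fun v _ => by positivity⟩
  rw [ENNReal.ofReal_sum_of_nonneg fun v _ => by positivity]
  refine Finset.sum_congr rfl fun v _ => ?_
  rw [ENNReal.ofReal_pow (norm_nonneg _), ofReal_norm]

/-- The square of the Hilbert–Schmidt norm of the transfer operator. -/
theorem tsum_enorm_transferOperator_sq {ι : Type*} (b : HilbertBasis ι ℂ (S.HilbertSpace N)) :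
    ∑' k, ‖S.transferOperator N σ (b k)‖ₑ ^ 2
      = ENNReal.ofReal (∑ i, ∑ j, (agreement σ i j : ℝ) * (S.bergmanIntegral i j).re) ∧
    0 ≤ ∑ i, ∑ j, (agreement σ i j : ℝ) * (S.bergmanIntegral i j).re := by
  have := b.countable_index
  set f : ℂ → ℝ := fun z => ∑ i, ∑ j, (agreement σ i j : ℝ) * (S.bergmanIntegrand i j z).re with hf
  have hfint : IntegrableOn f S.Ω := by
    refine integrable_finsetSum _ fun i _ => integrable_finsetSum _ fun j _ => ?_
    exact (S.integrableOn_bergmanIntegrand i j).re.const_mul _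
  have hfnn : 0 ≤ᵐ[volume.restrict (S.Ω : Set ℂ)] f := by
    filter_upwards [ae_restrict_mem S.Ω.isOpen.measurableSet] with z hz
    exact (S.sum_enorm_transferFunctional_sq σ ⟨z, hz⟩).2
  have hI : ∫ z in (S.Ω : Set ℂ), f z
      = ∑ i, ∑ j, (agreement σ i j : ℝ) * (S.bergmanIntegral i j).re := by
    have hre : ∀ i j, IntegrableOn (fun z => (agreement σ i j : ℝ) *
        (S.bergmanIntegrand i j z).re) S.Ω := fun i j =>
      (S.integrableOn_bergmanIntegrand i j).re.const_mul _
    rw [hf, integral_finsetSum _ fun i _ => integrable_finsetSum _ fun j _ => hre i j]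
    refine Finset.sum_congr rfl fun i _ => ?_
    rw [integral_finsetSum _ fun j _ => hre i j]
    refine Finset.sum_congr rfl fun j _ => ?_
    rw [integral_const_mul]
    congr 1
    exact integral_re (S.integrableOn_bergmanIntegrand i j)
  rw [← hI]
  refine ⟨?_, integral_nonneg_of_ae hfnn⟩
  rw [ofReal_integral_eq_lintegral_ofReal hfint hfnn]
  simp_rw [Bergman.enorm_sq_eq_lintegral]
  -- Tonelli for a countable basis. At each fixed `z` the sum over the basis is then Parseval for
  -- the `N` representing vectors.
  rw [← lintegral_tsum]
  · refine setLIntegral_congr_fun S.Ω.isOpen.measurableSet fun z hz => ?_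
    have h1 : ∀ k, ‖Bergman.extend (S.transferOperator N σ (b k)) z‖ₑ ^ 2
        = ∑ v, ‖inner ℂ (b k) (S.transferFunctional σ ⟨z, hz⟩ v)‖ₑ ^ 2 := by
      intro k
      rw [Bergman.extend_apply _ ⟨z, hz⟩, ← ofReal_norm, ← ENNReal.ofReal_pow (norm_nonneg _),
        EuclideanSpace.norm_sq_eq, ENNReal.ofReal_sum_of_nonneg fun v _ => by positivity]
      refine Finset.sum_congr rfl fun v _ => ?_
      rw [← inner_transferFunctional, ENNReal.ofReal_pow (norm_nonneg _), ofReal_norm,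
        ← inner_conj_symm, RCLike.enorm_conj]
    simp only [h1]
    rw [← (S.sum_enorm_transferFunctional_sq σ ⟨z, hz⟩).1,
      Summable.tsum_finsetSum fun v _ => ENNReal.summable]
    exact Finset.sum_congr rfl fun v _ => b.tsum_enorm_inner_sq _
  · intro k
    refine AEMeasurable.pow_const ?_ 2
    exact ((Bergman.extend_differentiableOn _).continuousOn.aestronglyMeasurable
      S.Ω.isOpen.measurableSet).enorm

theorem isCompactOperator_transferOperator_and_hasSum :
    IsCompactOperator (S.transferOperator N σ) ∧
      HasSum (fun j => singularValue (S.transferOperator N σ) j ^ 2)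
        (∑ i, ∑ j, (agreement σ i j : ℝ) * (S.bergmanIntegral i j).re) := by
  obtain ⟨w, b, -⟩ := exists_hilbertBasis ℂ (S.HilbertSpace N)
  obtain ⟨h1, h2⟩ := S.tsum_enorm_transferOperator_sq σ b
  exact hasSum_singularValue_sq b h2 h1

theorem agreement_self (i : Fin d) : agreement σ i i = N := by simp [agreement]

theorem agreement_comm (i j : Fin d) : agreement σ i j = agreement σ j i := by
  simp only [agreement, eq_comm]

/-- A permutation agrees with itself at all `N` points, which gives the first term. The matrix `H`
is Hermitian and agreement is symmetric, so `(i, j)` and `(j, i)` contribute equally, whence the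
factor 2. -/
theorem normSq_eq : S.normSq N σ = N * ∑ j, (S.bergmanIntegral j j).re
    + 2 * ∑ p : {p : Fin d × Fin d // p.1 < p.2},
      (agreement σ p.1.1 p.1.2 : ℝ) * (S.bergmanIntegral p.1.1 p.1.2).re := by
  rw [normSq, hilbertSchmidtSq, (S.isCompactOperator_transferOperator_and_hasSum σ).2.tsum_eq]
  set f : Fin d × Fin d → ℝ := fun p => (agreement σ p.1 p.2 : ℝ) * (S.bergmanIntegral p.1 p.2).re
    with hf
  have hsymm : ∀ p, f p.swap = f p := by
    intro p
    simp only [hf, Prod.fst_swap, Prod.snd_swap]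
    rw [agreement_comm, ← S.conj_bergmanIntegral, Complex.conj_re]
  have h1 : ∑ i, ∑ j, (agreement σ i j : ℝ) * (S.bergmanIntegral i j).re = ∑ p, f p := by
    rw [Fintype.sum_prod_type]
  have h2 : ∑ p : {p : Fin d × Fin d // p.1 < p.2}, f p.1
      = ∑ p ∈ Finset.univ.filter (fun p : Fin d × Fin d => p.1 < p.2), f p := by
    exact (Finset.sum_subtype _ (by simp) f).symm
  have h3 : ∑ p ∈ Finset.univ.filter (fun p : Fin d × Fin d => p.2 < p.1), f p
      = ∑ p ∈ Finset.univ.filter (fun p : Fin d × Fin d => p.1 < p.2), f p := by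
    refine Finset.sum_nbij' Prod.swap Prod.swap ?_ ?_ ?_ ?_ ?_
    · simp
    · simp
    · simp
    · simp
    · exact fun p _ => (hsymm p).symm
  have h4 : ∑ p ∈ Finset.univ.filter (fun p : Fin d × Fin d => p.1 = p.2), f p
      = N * ∑ j, (S.bergmanIntegral j j).re := by
    rw [Finset.mul_sum]
    refine Finset.sum_nbij' Prod.fst (fun j => (j, j)) ?_ ?_ ?_ ?_ ?_
    · simp
    · simp
    · rintro ⟨i, j⟩ h
      simpa using h
    · simp
    · rintro ⟨i, j⟩ h
      obtain rfl : i = j := by simpa using h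
      simp [hf, agreement_self]
  have h5 : ∑ p, f p = ∑ p ∈ Finset.univ.filter (fun p : Fin d × Fin d => p.1 = p.2), f p
      + (∑ p ∈ Finset.univ.filter (fun p : Fin d × Fin d => p.1 < p.2), f p
      + ∑ p ∈ Finset.univ.filter (fun p : Fin d × Fin d => p.2 < p.1), f p) := by
    simp only [Finset.sum_filter]
    rw [← Finset.sum_add_distrib, ← Finset.sum_add_distrib]
    refine Finset.sum_congr rfl fun p _ => ?_
    rcases lt_trichotomy p.1 p.2 with h | h | h
    · simp [h, h.ne, h.not_gt]
    · simp [h]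
    · simp [h, h.ne', h.not_gt]
  rw [h1, h5, h3, h4, ← h2, two_mul]

end ContractionSystem

/-! ### Agreement numbers of random permutations -/

section RandomPermutations

variable {d N : ℕ}

theorem integral_permLaw (f : (Fin d → Equiv.Perm (Fin N)) → ℝ) :
    ∫ σ, f σ ∂(permLaw d N) = (((N.factorial : ℝ))⁻¹) ^ d * ∑ σ, f σ := by
  rw [integral_fintype (Integrable.of_finite), Finset.mul_sum]
  refine Finset.sum_congr rfl fun σ _ => ?_
  rw [smul_eq_mul, permLaw, measureReal_def, Measure.pi_singleton]
  congr 1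
  simp [uniformOn_univ, Fintype.card_perm]

theorem integral_permLaw_comp_equiv
    (e : (Fin d → Equiv.Perm (Fin N)) ≃ (Fin d → Equiv.Perm (Fin N)))
    (f : (Fin d → Equiv.Perm (Fin N)) → ℝ) :
    ∫ σ, f (e σ) ∂(permLaw d N) = ∫ σ, f σ ∂(permLaw d N) := by
  rw [integral_permLaw, integral_permLaw, Equiv.sum_comp e f]

/-- Composition of the `i`-th permutation with the transposition of `x` and `y`. -/
def swapAt (i : Fin d) (x y : Fin N) (σ : Fin d → Equiv.Perm (Fin N)) :
    Fin d → Equiv.Perm (Fin N) :=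
  Function.update σ i (σ i * Equiv.swap x y)

theorem swapAt_involutive (i : Fin d) (x y : Fin N) : Function.Involutive (swapAt i x y) := by
  intro σ
  simp [swapAt, mul_assoc]

theorem swapAt_self (i : Fin d) (x y : Fin N) (σ : Fin d → Equiv.Perm (Fin N)) :
    swapAt i x y σ i = σ i * Equiv.swap x y := Function.update_self ..

theorem swapAt_of_ne {i l : Fin d} (h : l ≠ i) (x y : Fin N) (σ : Fin d → Equiv.Perm (Fin N)) :
    swapAt i x y σ l = σ l := Function.update_of_ne h ..

/-- The swap is a law-preserving involution: substituting it turns the event `σ i x = σ j x` into `σ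
i y = σ j x` and cancels the swap inside `h`. Exactly one `y`, namely `(σ i)⁻¹ (σ j x)`, satisfies
the new condition. -/
theorem sum_integral_swapAt {i j : Fin d} (hij : i ≠ j) (x : Fin N) (Y : Finset (Fin N))
    (h : (Fin d → Equiv.Perm (Fin N)) → ℝ) :
    ∑ y ∈ Y, ∫ σ, (if σ i x = σ j x then h (swapAt i x y σ) else 0) ∂(permLaw d N)
      = ∫ σ, (if (σ i).symm (σ j x) ∈ Y then h σ else 0) ∂(permLaw d N) := by
  have h1 : ∀ y, ∫ σ, (if σ i x = σ j x then h (swapAt i x y σ) else 0) ∂(permLaw d N)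
      = ∫ σ, (if (σ i).symm (σ j x) = y then h σ else 0) ∂(permLaw d N) := by
    intro y
    rw [← integral_permLaw_comp_equiv (swapAt_involutive i x y).toPerm]
    refine integral_congr_ae (Eventually.of_forall fun σ => ?_)
    simp only [Function.Involutive.coe_toPerm, swapAt_involutive i x y σ, swapAt_self,
      swapAt_of_ne hij.symm, Equiv.Perm.mul_apply, Equiv.swap_apply_left, Equiv.symm_apply_eq]
    simp only [eq_comm]
  simp_rw [h1]
  rw [← integral_finsetSum _ fun _ _ => Integrable.of_finite]
  refine integral_congr_ae (Eventually.of_forall fun σ => ?_)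
  simp only [Finset.sum_ite_eq]

theorem integral_eq_sum_swapAt {i j : Fin d} (hij : i ≠ j) (x : Fin N)
    (h : (Fin d → Equiv.Perm (Fin N)) → ℝ) :
    ∫ σ, h σ ∂(permLaw d N)
      = ∑ y, ∫ σ, (if σ i x = σ j x then h (swapAt i x y σ) else 0) ∂(permLaw d N) := by
  rw [sum_integral_swapAt hij]
  simp

/-- The set of points where the `i`-th and the `j`-th permutation agree. -/
def agreeSet (σ : Fin d → Equiv.Perm (Fin N)) (i j : Fin d) : Finset (Fin N) :=
  Finset.univ.filter fun v => σ i v = σ j v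

theorem mem_agreeSet {σ : Fin d → Equiv.Perm (Fin N)} {i j : Fin d} {v : Fin N} :
    v ∈ agreeSet σ i j ↔ σ i v = σ j v := by simp [agreeSet]

theorem card_agreeSet (σ : Fin d → Equiv.Perm (Fin N)) (i j : Fin d) :
    (agreeSet σ i j).card = agreement σ i j := rfl

/-- Each new point `x` costs a factor `1 / (N - |A|)`: a swap of `x` with some `y` outside `A`
leaves the agreements on `A` alone, and all these `y` contribute equally. The position `(σ i)⁻¹ (σ j
x)` cannot lie in `A` when the permutations agree on `A`, by injectivity, so restricting to `Aᶜ`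
loses nothing. -/
theorem descFactorial_mul_integral_subset_agreeSet {i j : Fin d} (hij : i ≠ j)
    (A : Finset (Fin N)) :
    (N.descFactorial A.card : ℝ) *
      ∫ σ, (if A ⊆ agreeSet σ i j then 1 else 0 : ℝ) ∂(permLaw d N) = 1 := by
  induction A using Finset.induction_on with
  | empty => simp
  | insert x A hx ih =>
    have hsum := sum_integral_swapAt (d := d) hij x Aᶜ
      fun σ => (if A ⊆ agreeSet σ i j then 1 else 0 : ℝ)
    have hR : ∀ σ : Fin d → Equiv.Perm (Fin N), (if (σ i).symm (σ j x) ∈ Aᶜ then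
        (if A ⊆ agreeSet σ i j then 1 else 0 : ℝ) else 0) = if A ⊆ agreeSet σ i j then 1 else 0 := by
      intro σ
      split_ifs with h1 h2 h2
      · rfl
      · rfl
      · exfalso
        rw [Finset.mem_compl, not_not] at h1
        have h3 := mem_agreeSet.1 (h2 h1)
        rw [Equiv.apply_symm_apply] at h3
        rw [← (σ j).injective h3] at h1
        exact hx h1
      · rfl
    have hL : ∀ y ∈ Aᶜ, ∫ σ, (if σ i x = σ j x then
        (if A ⊆ agreeSet (swapAt i x y σ) i j then 1 else 0 : ℝ) else 0) ∂(permLaw d N)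
        = ∫ σ, (if insert x A ⊆ agreeSet σ i j then 1 else 0 : ℝ) ∂(permLaw d N) := by
      intro y hy
      rw [Finset.mem_compl] at hy
      refine integral_congr_ae (Eventually.of_forall fun σ => ?_)
      have h1 : A ⊆ agreeSet (swapAt i x y σ) i j ↔ A ⊆ agreeSet σ i j := by
        refine forall₂_congr fun v hv => ?_
        have hvx : v ≠ x := fun h => hx (h ▸ hv)
        have hvy : v ≠ y := fun h => hy (h ▸ hv)
        rw [mem_agreeSet, mem_agreeSet, swapAt_self, swapAt_of_ne hij.symm, Equiv.Perm.mul_apply,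
          Equiv.swap_apply_of_ne_of_ne hvx hvy]
      simp only [Finset.insert_subset_iff, mem_agreeSet, h1]
      split_ifs <;> simp_all
    rw [Finset.sum_congr rfl hL, Finset.sum_const, Finset.card_compl, Fintype.card_fin,
      nsmul_eq_mul] at hsum
    simp only [hR] at hsum
    rw [Finset.card_insert_of_notMem hx, Nat.descFactorial_succ, Nat.cast_mul, mul_right_comm,
      mul_comm _ (N.descFactorial A.card : ℝ), hsum, ih]

/-- The binomial coefficient counts the `k`-subsets on which the permutations agree, each having
probability `1 / N.descFactorial k`. The value is `1 / k!` for `k ≤ N` and 0 beyond, hence an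
inequality. -/
theorem integral_choose_agreement_le {i j : Fin d} (hij : i ≠ j) (k : ℕ) :
    ∫ σ, ((agreement σ i j).choose k : ℝ) ∂(permLaw d N) ≤ 1 / k.factorial := by
  have h1 : ∀ σ : Fin d → Equiv.Perm (Fin N), ((agreement σ i j).choose k : ℝ)
      = ∑ A ∈ Finset.powersetCard k Finset.univ, if A ⊆ agreeSet σ i j then 1 else 0 := by
    intro σ
    rw [← card_agreeSet, ← Finset.card_powersetCard, Finset.sum_boole]
    congr 2
    ext A
    simp [Finset.mem_powersetCard, and_comm]
  simp_rw [h1]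
  rw [integral_finsetSum _ fun _ _ => Integrable.of_finite]
  have h2 : ∀ A ∈ Finset.powersetCard k (Finset.univ : Finset (Fin N)),
      ∫ σ, (if A ⊆ agreeSet σ i j then 1 else 0 : ℝ) ∂(permLaw d N)
        = (N.descFactorial k : ℝ)⁻¹ := by
    intro A hA
    have h3 := descFactorial_mul_integral_subset_agreeSet (d := d) hij A
    rw [(Finset.mem_powersetCard.1 hA).2] at h3
    exact (inv_eq_of_mul_eq_one_right h3).symm
  rw [Finset.sum_congr rfl h2, Finset.sum_const, Finset.card_powersetCard, Finset.card_univ,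
    Fintype.card_fin, nsmul_eq_mul, Nat.descFactorial_eq_factorial_mul_choose]
  push_cast
  rcases eq_or_ne ((N.choose k : ℝ)) 0 with h0 | h0
  · rw [h0]; simp
  · rw [mul_inv, mul_comm, mul_assoc, inv_mul_cancel₀ h0, mul_one, one_div]

/-- Expanding by the binomial theorem in the binomial moments compares the generating function with
that of a Poisson variable of parameter 1, uniformly in `N`. -/
theorem integral_one_add_pow_agreement_le {i j : Fin d} (hij : i ≠ j) {t : ℝ} (ht : 0 ≤ t) :
    ∫ σ, (1 + t) ^ agreement σ i j ∂(permLaw d N) ≤ Real.exp t := by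
  have h1 : ∀ σ : Fin d → Equiv.Perm (Fin N), (1 + t) ^ agreement σ i j
      = ∑ k ∈ Finset.range (N + 1), t ^ k * ((agreement σ i j).choose k : ℝ) := by
    intro σ
    rw [add_comm, add_pow]
    have hle : agreement σ i j ≤ N := by
      simpa [agreement] using Finset.card_filter_le (Finset.univ : Finset (Fin N)) _
    simp only [one_pow, mul_one]
    refine Finset.sum_subset (Finset.range_subset_range.2 (by omega)) fun k _ hk => ?_
    rw [Nat.choose_eq_zero_of_lt (by simpa using hk)]
    simp
  simp_rw [h1]
  rw [integral_finsetSum _ fun _ _ => Integrable.of_finite]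
  refine le_trans (Finset.sum_le_sum fun k _ => ?_) (Real.sum_le_exp_of_nonneg ht (N + 1))
  rw [integral_const_mul, div_eq_mul_one_div]
  exact mul_le_mul_of_nonneg_left (integral_choose_agreement_le hij k) (by positivity)

/-- If `h` ignores swaps in `σ_l`, then all `N` terms of the exchange identity coincide: the
agreement at `x` has probability `1 / N` and is uncorrelated with `h`. -/
theorem natCast_mul_integral_ite_eq {l j : Fin d} (hlj : l ≠ j) (x : Fin N)
    {h : (Fin d → Equiv.Perm (Fin N)) → ℝ} (hh : ∀ y σ, h (swapAt l x y σ) = h σ) :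
    N * ∫ σ, (if σ l x = σ j x then h σ else 0) ∂(permLaw d N) = ∫ σ, h σ ∂(permLaw d N) := by
  rw [integral_eq_sum_swapAt hlj x h]
  simp only [hh]
  simp

theorem sq_mul_integral_triple {i j l : Fin d} (hij : i ≠ j) (hli : l ≠ i) (hlj : l ≠ j)
    (x : Fin N) :
    (N : ℝ) ^ 2 * ∫ σ, (if σ l x = σ j x then (if σ i x = σ j x then 1 else 0) else 0 : ℝ)
      ∂(permLaw d N) = 1 := by
  rw [sq, mul_assoc, natCast_mul_integral_ite_eq hlj, natCast_mul_integral_ite_eq hij]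
  · simp
  · simp
  · intro y σ
    rw [swapAt_of_ne hli.symm, swapAt_of_ne hlj.symm]

end RandomPermutations

/-- The pairs of indices `i < j`. -/
abbrev IndexPair (d : ℕ) : Type := {p : Fin d × Fin d // p.1 < p.2}

/-! ### Joint agreements: effect of a transposition and exponential moments -/

section AgreementVector

variable {d N : ℕ}

/-- The numbers of agreements of all pairs of permutations. -/
def agreements (σ : Fin d → Equiv.Perm (Fin N)) (p : IndexPair d) : ℕ :=
  agreement σ p.1.1 p.1.2

/-- The total number of agreements. -/
def totalAgreement (σ : Fin d → Equiv.Perm (Fin N)) : ℕ := ∑ p, agreements σ p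

theorem agreement_le_total (σ : Fin d → Equiv.Perm (Fin N)) {i l : Fin d} (h : l ≠ i) :
    agreement σ l i ≤ totalAgreement σ := by
  have h1 : ∀ p, agreements σ p ≤ totalAgreement σ := fun p =>
    Finset.single_le_sum (f := agreements σ) (fun _ _ => Nat.zero_le _) (Finset.mem_univ p)
  rcases lt_or_gt_of_ne h with h | h
  · exact h1 ⟨(l, i), h⟩
  · rw [show agreement σ l i = agreement σ i l by simp only [agreement, eq_comm]]
    exact h1 ⟨(i, l), h⟩

theorem agreement_swapAt_le (σ : Fin d → Equiv.Perm (Fin N)) (a i j : Fin d) (x y : Fin N) :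
    agreement (swapAt a x y σ) i j ≤ agreement σ i j + 2 := by
  have hsub : agreeSet (swapAt a x y σ) i j ⊆ agreeSet σ i j ∪ {x, y} := by
    intro v hv
    by_cases hx : v = x
    · simp [hx]
    by_cases hy : v = y
    · simp [hy]
    have h1 : ∀ l, swapAt a x y σ l v = σ l v := by
      intro l
      by_cases hl : l = a
      · rw [hl, swapAt_self, Equiv.Perm.mul_apply, Equiv.swap_apply_of_ne_of_ne hx hy]
      · rw [swapAt_of_ne hl]
    rw [mem_agreeSet, h1, h1] at hv
    exact Finset.mem_union_left _ (mem_agreeSet.2 hv)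
  calc agreement (swapAt a x y σ) i j ≤ (agreeSet σ i j ∪ {x, y}).card := Finset.card_le_card hsub
    _ ≤ agreement σ i j + 2 := (Finset.card_union_le _ _).trans
        (Nat.add_le_add_left Finset.card_le_two _)

theorem totalAgreement_swapAt_add_le (σ : Fin d → Equiv.Perm (Fin N)) (a : Fin d) (x y : Fin N)
    (p : IndexPair d) :
    ∑ q, (agreements (swapAt a x y σ) q + Pi.single (M := fun _ => ℕ) p 1 q)
      ≤ totalAgreement σ + (2 * Fintype.card (IndexPair d) + 1) := by
  rw [Finset.sum_add_distrib]
  have h1 : ∑ q, Pi.single (M := fun _ => ℕ) p 1 q = 1 := by simp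
  have h2 : ∑ q, agreements (swapAt a x y σ) q ≤ ∑ q : IndexPair d, (agreements σ q + 2) :=
    Finset.sum_le_sum fun q _ => agreement_swapAt_le σ a _ _ x y
  rw [Finset.sum_add_distrib, Finset.sum_const, Finset.card_univ, smul_eq_mul] at h2
  rw [h1, totalAgreement]
  omega

/-- If no other coincidence occurs at `x` and `y`, composing `σ_i` with the transposition of `x`
and `y` destroys the agreement of `σ_i` and `σ_j` at `x` and changes nothing else. -/
theorem agreements_swapAt_add_single (σ : Fin d → Equiv.Perm (Fin N)) (p : IndexPair d)
    {x y : Fin N} (hx : σ p.1.1 x = σ p.1.2 x)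
    (h1 : ∀ l ≠ p.1.1, σ l y ≠ σ p.1.1 y ∧ σ p.1.1 y ≠ σ l x ∧ σ l y ≠ σ p.1.1 x)
    (h2 : ∀ l ≠ p.1.1, l ≠ p.1.2 → σ l x ≠ σ p.1.1 x) (q : IndexPair d) :
    agreements (swapAt p.1.1 x y σ) q + Pi.single (M := fun _ => ℕ) p 1 q = agreements σ q := by
  obtain ⟨⟨i, j⟩, hij⟩ := p
  simp only at hij hx h1 h2 ⊢
  have hji : j ≠ i := hij.ne'
  have hyx : y ≠ x := by
    rintro rfl
    exact (h1 j hji).1 hx.symm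
  have hi : ∀ v, swapAt i x y σ i v = σ i (Equiv.swap x y v) := fun v => by
    rw [swapAt_self, Equiv.Perm.mul_apply]
  have hoff : ∀ l ≠ i, l ≠ j → agreement (swapAt i x y σ) i l = agreement σ i l := by
    intro l hli hlj
    rw [← card_agreeSet, ← card_agreeSet]
    congr 1
    ext v
    rw [mem_agreeSet, mem_agreeSet, hi, swapAt_of_ne hli]
    by_cases hvx : v = x
    · subst hvx
      rw [Equiv.swap_apply_left]
      exact iff_of_false (h1 l hli).2.1 (h2 l hli hlj).symm
    by_cases hvy : v = y
    · subst hvy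
      rw [Equiv.swap_apply_right]
      exact iff_of_false (h1 l hli).2.2.symm (h1 l hli).1.symm
    rw [Equiv.swap_apply_of_ne_of_ne hvx hvy]
  have hon : agreement (swapAt i x y σ) i j + 1 = agreement σ i j := by
    have h3 : agreeSet (swapAt i x y σ) i j = (agreeSet σ i j).erase x := by
      ext v
      rw [Finset.mem_erase, mem_agreeSet, mem_agreeSet, hi, swapAt_of_ne hji]
      by_cases hvx : v = x
      · subst hvx
        rw [Equiv.swap_apply_left]
        exact iff_of_false (h1 j hji).2.1 (by simp)
      by_cases hvy : v = y
      · subst hvy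
        rw [Equiv.swap_apply_right]
        exact iff_of_false (h1 j hji).2.2.symm fun h => (h1 j hji).1 h.2.symm
      rw [Equiv.swap_apply_of_ne_of_ne hvx hvy]
      simp [hvx]
    rw [← card_agreeSet, ← card_agreeSet, h3,
      Finset.card_erase_add_one (mem_agreeSet.2 hx)]
  obtain ⟨⟨a, b⟩, hab⟩ := q
  simp only [agreements] at hab ⊢
  by_cases hai : a = i
  · subst hai
    by_cases hbj : b = j
    · subst hbj
      rw [Pi.single_eq_same, hon]
    · rw [Pi.single_eq_of_ne (by simpa [Subtype.ext_iff] using hbj), add_zero,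
        hoff b hab.ne' hbj]
  rw [Pi.single_eq_of_ne (by simp [Subtype.ext_iff, hai]), add_zero]
  by_cases hbi : b = i
  · subst hbi
    have hcomm : ∀ τ : Fin d → Equiv.Perm (Fin N), agreement τ a b = agreement τ b a := fun τ => by
      simp only [agreement, eq_comm]
    rw [hcomm, hcomm, hoff a hai (hab.trans hij).ne]
  · simp only [agreement, swapAt_of_ne hai, swapAt_of_ne hbi]

/-- Exponential moments of the total number of agreements are bounded uniformly in `N`. -/
theorem exists_integral_pow_totalAgreement_le (d : ℕ) {A : ℝ} (hA : 1 ≤ A) :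
    ∃ M : ℝ, ∀ N : ℕ, ∫ σ, A ^ totalAgreement σ ∂(permLaw d N) ≤ M := by
  set m := Fintype.card (IndexPair d) with hm
  refine ⟨1 + m * Real.exp (A ^ m), fun N => ?_⟩
  -- The total is at most `m` times the largest agreement number, so one pair dominates and no joint
  -- information is needed. The summand 1 covers the case without pairs.
  have h1 : ∀ σ : Fin d → Equiv.Perm (Fin N),
      A ^ totalAgreement σ ≤ 1 + ∑ p : IndexPair d, (1 + A ^ m) ^ agreements σ p := by
    intro σ
    have hnn : ∀ p ∈ (Finset.univ : Finset (IndexPair d)), 0 ≤ (1 + A ^ m) ^ agreements σ p :=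
      fun p _ => by positivity
    rcases isEmpty_or_nonempty (IndexPair d) with hempty | hne
    · simp [totalAgreement]
    · obtain ⟨q, -, hq⟩ := Finset.exists_max_image Finset.univ (agreements σ) Finset.univ_nonempty
      have h2 : totalAgreement σ ≤ m * agreements σ q := by
        have := Finset.sum_le_card_nsmul Finset.univ (agreements σ) _ hq
        simpa [totalAgreement, hm, Finset.card_univ] using this
      calc A ^ totalAgreement σ ≤ A ^ (m * agreements σ q) := pow_le_pow_right₀ hA h2
        _ = (A ^ m) ^ agreements σ q := pow_mul _ _ _
        _ ≤ (1 + A ^ m) ^ agreements σ q := by gcongr; linarith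
        _ ≤ ∑ p : IndexPair d, (1 + A ^ m) ^ agreements σ p :=
            Finset.single_le_sum hnn (Finset.mem_univ q)
        _ ≤ _ := by linarith
  calc ∫ σ, A ^ totalAgreement σ ∂(permLaw d N)
      ≤ ∫ σ, (1 + ∑ p : IndexPair d, (1 + A ^ m) ^ agreements σ p) ∂(permLaw d N) :=
        integral_mono Integrable.of_finite Integrable.of_finite h1
    _ = 1 + ∑ p : IndexPair d, ∫ σ, (1 + A ^ m) ^ agreements σ p ∂(permLaw d N) := by
        rw [integral_add Integrable.of_finite Integrable.of_finite,
          integral_finsetSum _ fun _ _ => Integrable.of_finite]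
        simp
    _ ≤ 1 + ∑ p : IndexPair d, Real.exp (A ^ m) := by
        gcongr with p
        exact integral_one_add_pow_agreement_le p.2.ne (by positivity)
    _ = _ := by simp [hm]

/-- The weight of the coincidences at `x` and `y` that obstruct
`agreements_swapAt_add_single`. -/
def coincidences (σ : Fin d → Equiv.Perm (Fin N)) (p : IndexPair d) (x y : Fin N) : ℝ :=
  (∑ l ∈ Finset.univ.filter (fun l => l ≠ p.1.1), ((if σ l y = σ p.1.1 y then 1 else 0)
    + (if σ p.1.1 y = σ l x then 1 else 0) + (if σ l y = σ p.1.1 x then 1 else 0)))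
  + ∑ l ∈ Finset.univ.filter (fun l => l ≠ p.1.1 ∧ l ≠ p.1.2),
      if σ l x = σ p.1.2 x then 1 else 0

/-- The number of points where `σ_i`, `σ_j` and a third permutation agree. -/
def tripleAgreement (σ : Fin d → Equiv.Perm (Fin N)) (p : IndexPair d) : ℝ :=
  ∑ x, ∑ l ∈ Finset.univ.filter (fun l => l ≠ p.1.1 ∧ l ≠ p.1.2),
    if σ l x = σ p.1.2 x then (if σ p.1.1 x = σ p.1.2 x then 1 else 0) else 0

theorem tripleAgreement_nonneg (σ : Fin d → Equiv.Perm (Fin N)) (p : IndexPair d) :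
    0 ≤ tripleAgreement σ p :=
  Finset.sum_nonneg fun _ _ => Finset.sum_nonneg fun _ _ => by split_ifs <;> simp

theorem sum_ite_agree (σ : Fin d → Equiv.Perm (Fin N)) (i j : Fin d) :
    ∑ x, (if σ i x = σ j x then 1 else 0 : ℝ) = agreement σ i j := by
  rw [Finset.sum_boole]; rfl

theorem tripleAgreement_le (σ : Fin d → Equiv.Perm (Fin N)) (p : IndexPair d) :
    tripleAgreement σ p ≤ d * totalAgreement σ := by
  have h1 : (agreement σ p.1.1 p.1.2 : ℝ) ≤ totalAgreement σ := by
    exact_mod_cast agreement_le_total σ p.2.ne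
  calc tripleAgreement σ p
      ≤ ∑ x, ∑ l : Fin d, (if σ p.1.1 x = σ p.1.2 x then 1 else 0 : ℝ) := by
        refine Finset.sum_le_sum fun x _ => ?_
        refine (Finset.sum_le_sum fun l _ => ?_).trans (Finset.sum_le_sum_of_subset_of_nonneg
          (Finset.filter_subset _ _) fun l _ _ => ?_)
        · split_ifs <;> simp
        · split_ifs <;> simp
    _ = d * agreement σ p.1.1 p.1.2 := by
        simp only [Finset.sum_const, Finset.card_univ, Fintype.card_fin, nsmul_eq_mul]
        rw [← Finset.mul_sum, sum_ite_agree]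
    _ ≤ _ := by gcongr

/-- At each of the `N` points, a given third permutation joins the agreement with probability `N⁻²`,
and there are at most `d` candidates. -/
theorem integral_tripleAgreement_le (hN : 0 < N) (p : IndexPair d) :
    ∫ σ, tripleAgreement σ p ∂(permLaw d N) ≤ d / N := by
  have hN' : (0 : ℝ) < N := by exact_mod_cast hN
  have h1 : ∀ (x : Fin N), ∀ l ∈ Finset.univ.filter (fun l => l ≠ p.1.1 ∧ l ≠ p.1.2),
      ∫ σ, (if σ l x = σ p.1.2 x then (if σ p.1.1 x = σ p.1.2 x then 1 else 0) else 0 : ℝ)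
        ∂(permLaw d N) = ((N : ℝ) ^ 2)⁻¹ := by
    intro x l hl
    rw [Finset.mem_filter_univ] at hl
    exact (inv_eq_of_mul_eq_one_right (sq_mul_integral_triple p.2.ne hl.1 hl.2 x)).symm
  simp only [tripleAgreement]
  rw [integral_finsetSum _ fun _ _ => Integrable.of_finite]
  calc ∑ x : Fin N, ∫ σ, (∑ l ∈ Finset.univ.filter (fun l => l ≠ p.1.1 ∧ l ≠ p.1.2),
        if σ l x = σ p.1.2 x then (if σ p.1.1 x = σ p.1.2 x then 1 else 0) else 0 : ℝ)
        ∂(permLaw d N)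
      ≤ ∑ x : Fin N, d * ((N : ℝ) ^ 2)⁻¹ := by
        refine Finset.sum_le_sum fun x _ => ?_
        rw [integral_finsetSum _ fun _ _ => Integrable.of_finite, Finset.sum_congr rfl (h1 x),
          Finset.sum_const, nsmul_eq_mul]
        gcongr
        simpa using Finset.card_filter_le (Finset.univ : Finset (Fin d)) _
    _ = d / N := by
        simp only [Finset.sum_const, Finset.card_univ, Fintype.card_fin, nsmul_eq_mul]
        field_simp

theorem coincidences_nonneg (σ : Fin d → Equiv.Perm (Fin N)) (p : IndexPair d) (x y : Fin N) :
    0 ≤ coincidences σ p x y := by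
  refine add_nonneg (Finset.sum_nonneg fun _ _ => ?_) (Finset.sum_nonneg fun _ _ => ?_)
  · split_ifs <;> norm_num
  · split_ifs <;> norm_num

/-- Replaces the event that the transposition has side effects by a weight that can be summed over
`x` and `y`. -/
theorem one_le_coincidences {σ : Fin d → Equiv.Perm (Fin N)} {p : IndexPair d} {x y : Fin N}
    (hx : σ p.1.1 x = σ p.1.2 x)
    (h : agreements (swapAt p.1.1 x y σ) + Pi.single p 1 ≠ agreements σ) :
    1 ≤ coincidences σ p x y := by
  by_contra! hlt
  refine h (funext (agreements_swapAt_add_single σ p hx ?_ ?_))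
  · intro l hl
    by_contra hcon
    have h1 : (1 : ℝ) ≤ (if σ l y = σ p.1.1 y then 1 else 0)
        + (if σ p.1.1 y = σ l x then 1 else 0) + (if σ l y = σ p.1.1 x then 1 else 0) := by
      split_ifs with e1 e2 e3 e3 e2 e3 e3
      all_goals first | (norm_num; done) | exact (hcon ⟨e1, e2, e3⟩).elim
    have h2 := Finset.single_le_sum (s := Finset.univ.filter (fun l => l ≠ p.1.1))
      (f := fun l => ((if σ l y = σ p.1.1 y then 1 else 0)
        + (if σ p.1.1 y = σ l x then 1 else 0) + (if σ l y = σ p.1.1 x then 1 else 0) : ℝ))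
      (fun l _ => by split_ifs <;> norm_num) (Finset.mem_filter_univ l |>.2 hl)
    have h3 : 0 ≤ ∑ l ∈ Finset.univ.filter (fun l => l ≠ p.1.1 ∧ l ≠ p.1.2),
      (if σ l x = σ p.1.2 x then 1 else 0 : ℝ) :=
        Finset.sum_nonneg fun _ _ => by split_ifs <;> norm_num
    rw [coincidences] at hlt
    linarith
  · intro l hl1 hl2 hcon
    have h2 := Finset.single_le_sum
      (s := Finset.univ.filter (fun l => l ≠ p.1.1 ∧ l ≠ p.1.2))
      (f := fun l => (if σ l x = σ p.1.2 x then 1 else 0 : ℝ))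
      (fun l _ => by split_ifs <;> norm_num) (Finset.mem_filter_univ l |>.2 ⟨hl1, hl2⟩)
    have h3 : 0 ≤ ∑ l ∈ Finset.univ.filter (fun l => l ≠ p.1.1),
      ((if σ l y = σ p.1.1 y then 1 else 0)
        + (if σ p.1.1 y = σ l x then 1 else 0) + (if σ l y = σ p.1.1 x then 1 else 0) : ℝ) :=
        Finset.sum_nonneg fun _ _ => by split_ifs <;> norm_num
    simp only [hcon, hx, if_true] at h2
    rw [coincidences] at hlt
    linarith

/-- For fixed `x`, a condition `σ l y = c` holds for one `y` only, which accounts for the `+ 2`, and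
the agreements at `y` sum to at most the total. The coincidences at `x` do not depend on `y`: they
acquire a factor `N` and leave the triple agreements, which are rare. -/
theorem sum_coincidences_le (σ : Fin d → Equiv.Perm (Fin N)) (p : IndexPair d) :
    ∑ x, ∑ y, (if σ p.1.1 x = σ p.1.2 x then coincidences σ p x y else 0)
      ≤ d * (totalAgreement σ * (totalAgreement σ + 2)) + N * tripleAgreement σ p := by
  have hperm : ∀ (l : Fin d) (c : Fin N), ∑ y, (if σ l y = c then 1 else 0 : ℝ) = 1 := by
    intro l c
    simp only [← Equiv.eq_symm_apply]
    simp
  have hy : ∀ x, ∑ y, coincidences σ p x y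
      ≤ d * (totalAgreement σ + 2) + N * ∑ l ∈ Finset.univ.filter
        (fun l => l ≠ p.1.1 ∧ l ≠ p.1.2), (if σ l x = σ p.1.2 x then 1 else 0 : ℝ) := by
    intro x
    simp only [coincidences]
    rw [Finset.sum_add_distrib, Finset.sum_const, Finset.card_univ, Fintype.card_fin, nsmul_eq_mul,
      Finset.sum_comm]
    gcongr
    calc ∑ l ∈ Finset.univ.filter (fun l => l ≠ p.1.1), ∑ y, ((if σ l y = σ p.1.1 y then 1 else 0)
          + (if σ p.1.1 y = σ l x then 1 else 0) + (if σ l y = σ p.1.1 x then 1 else 0) : ℝ)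
        ≤ ∑ l ∈ Finset.univ.filter (fun l => l ≠ p.1.1), ((totalAgreement σ : ℝ) + 2) := by
          refine Finset.sum_le_sum fun l hl => ?_
          rw [Finset.sum_add_distrib, Finset.sum_add_distrib, hperm, hperm, sum_ite_agree]
          have hl' : l ≠ p.1.1 := (Finset.mem_filter_univ l).1 hl
          have : (agreement σ l p.1.1 : ℝ) ≤ totalAgreement σ :=
            Nat.cast_le.2 (agreement_le_total σ hl')
          linarith
      _ ≤ d * (totalAgreement σ + 2) := by
          rw [Finset.sum_const, nsmul_eq_mul]
          gcongr
          simpa using Finset.card_filter_le (Finset.univ : Finset (Fin d)) _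
  have h1 : (agreement σ p.1.1 p.1.2 : ℝ) ≤ totalAgreement σ := by
    exact_mod_cast agreement_le_total σ p.2.ne
  calc ∑ x, ∑ y, (if σ p.1.1 x = σ p.1.2 x then coincidences σ p x y else 0)
      ≤ ∑ x, ((if σ p.1.1 x = σ p.1.2 x then 1 else 0) * (d * (totalAgreement σ + 2 : ℝ))
          + N * ∑ l ∈ Finset.univ.filter (fun l => l ≠ p.1.1 ∧ l ≠ p.1.2),
            (if σ l x = σ p.1.2 x then (if σ p.1.1 x = σ p.1.2 x then 1 else 0) else 0 : ℝ)) := by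
        refine Finset.sum_le_sum fun x _ => ?_
        by_cases hx : σ p.1.1 x = σ p.1.2 x
        · simp only [hx, if_true, one_mul]
          exact hy x
        · simp [hx]
    _ = agreement σ p.1.1 p.1.2 * (d * (totalAgreement σ + 2 : ℝ))
          + N * tripleAgreement σ p := by
        rw [Finset.sum_add_distrib, ← Finset.sum_mul, sum_ite_agree, ← Finset.mul_sum]
        rfl
    _ ≤ totalAgreement σ * (d * (totalAgreement σ + 2 : ℝ)) + N * tripleAgreement σ p := by
        gcongr
    _ = _ := by ring

end AgreementVector

/-! ### Approximate Stein equation and mixed factorial moments -/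

section FactorialMoments

variable {d : ℕ}

/-- The agreement number is the sum over `x` of the indicators of agreement, and the exchange
identity rewrites the shifted expectation at every `x`. Multiplying by `N` lets both terms run over
the same pairs `(x, y)`. -/
theorem natCast_mul_steinDifference_eq {N : ℕ} (p : IndexPair d) (g : (IndexPair d → ℕ) → ℝ) :
    N * (∫ σ, (agreements σ p : ℝ) * g (agreements σ) ∂(permLaw d N)
      - ∫ σ, g (agreements σ + Pi.single p 1) ∂(permLaw d N))
    = ∫ σ, ∑ x, ∑ y, (if σ p.1.1 x = σ p.1.2 x then g (agreements σ)
        - g (agreements (swapAt p.1.1 x y σ) + Pi.single p 1) else 0) ∂(permLaw d N) := by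
  have h1 : ∀ x : Fin N, ∫ σ, g (agreements σ + Pi.single p 1) ∂(permLaw d N)
      = ∑ y, ∫ σ, (if σ p.1.1 x = σ p.1.2 x then
          g (agreements (swapAt p.1.1 x y σ) + Pi.single p 1) else 0) ∂(permLaw d N) := fun x =>
    integral_eq_sum_swapAt p.2.ne x fun σ => g (agreements σ + Pi.single p 1)
  have h2 : ∀ σ : Fin d → Equiv.Perm (Fin N), (N : ℝ) * ((agreements σ p : ℝ) * g (agreements σ))
      = ∑ x, ∑ _y : Fin N, if σ p.1.1 x = σ p.1.2 x then g (agreements σ) else 0 := by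
    intro σ
    simp only [Finset.sum_const, Finset.card_univ, Fintype.card_fin, nsmul_eq_mul]
    rw [← Finset.mul_sum, agreements, ← sum_ite_agree, Finset.sum_mul]
    congr 1
    exact Finset.sum_congr rfl fun x _ => by split_ifs <;> simp
  have h3 : N * ∫ σ, g (agreements σ + Pi.single p 1) ∂(permLaw d N)
      = ∫ σ, ∑ x, ∑ y, (if σ p.1.1 x = σ p.1.2 x then
          g (agreements (swapAt p.1.1 x y σ) + Pi.single p 1) else 0) ∂(permLaw d N) := by
    rw [integral_finsetSum _ fun _ _ => Integrable.of_finite]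
    simp_rw [integral_finsetSum _ fun _ _ => Integrable.of_finite]
    simp_rw [← h1]
    simp
  rw [mul_sub, h3, ← integral_const_mul]
  simp_rw [h2]
  rw [← integral_sub Integrable.of_finite Integrable.of_finite]
  refine integral_congr_ae (Eventually.of_forall fun σ => ?_)
  simp only [← Finset.sum_sub_distrib]
  refine Finset.sum_congr rfl fun x _ => Finset.sum_congr rfl fun y _ => ?_
  split_ifs <;> simp

/-- The numbers of agreements satisfy the Stein equation of independent Poisson variables up to
an error of order `N ^ (-1/2)`. -/
theorem exists_abs_steinDifference_le (p : IndexPair d) {g : (IndexPair d → ℕ) → ℝ} {C A : ℝ}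
    (hA : 1 ≤ A) (hC : 0 ≤ C) (hg : ∀ n, |g n| ≤ C * A ^ ∑ q, n q) :
    ∃ M : ℝ, ∀ N : ℕ, 0 < N → |∫ σ, (agreements σ p : ℝ) * g (agreements σ) ∂(permLaw d N)
      - ∫ σ, g (agreements σ + Pi.single p 1) ∂(permLaw d N)| ≤ M / √N := by
  -- Bounds the difference of two values of `g`: a swap changes each agreement number by at most 2
  -- upwards, and the shift adds 1.
  set D : ℝ := 2 * C * A ^ (2 * Fintype.card (IndexPair d) + 1) with hD
  have hD0 : 0 ≤ D := by positivity
  -- With `s ≤ 2 ^ s` and `s + 2 ≤ 2 * 2 ^ s`, the polynomial factors are absorbed: `2 * 2 * A` is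
  -- the base for the pairwise coincidences, and `2 * A ^ 2` the one for the quadratic term of the
  -- truncation below.
  obtain ⟨M₁, hM₁⟩ := exists_integral_pow_totalAgreement_le d (A := 4 * A) (by linarith)
  obtain ⟨M₂, hM₂⟩ := exists_integral_pow_totalAgreement_le d (A := 2 * A ^ 2)
    (by nlinarith)
  have hM₁0 : 0 ≤ M₁ := (integral_nonneg fun σ => by positivity).trans (hM₁ 0)
  refine ⟨2 * d * D * M₁ + d + d * D ^ 2 * M₂, fun N hN => ?_⟩
  have hN' : (1 : ℝ) ≤ N := by exact_mod_cast hN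
  set K : ℝ := √N with hK
  have hK1 : 1 ≤ K := Real.one_le_sqrt.2 hN'
  have hK2 : K * K = N := Real.mul_self_sqrt (by linarith)
  have hpt : ∀ σ : Fin d → Equiv.Perm (Fin N), |∑ x, ∑ y, (if σ p.1.1 x = σ p.1.2 x then
      g (agreements σ) - g (agreements (swapAt p.1.1 x y σ) + Pi.single p 1) else 0)|
      ≤ 2 * d * D * (4 * A) ^ totalAgreement σ + N * K * tripleAgreement σ p
        + N / K * (d * D ^ 2) * (2 * A ^ 2) ^ totalAgreement σ := by
    intro σ
    set s := totalAgreement σ with hs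
    set T := tripleAgreement σ p with hT
    set B := D * A ^ s with hB
    have hB0 : 0 ≤ B := by positivity
    have hT0 : 0 ≤ T := tripleAgreement_nonneg σ p
    have hTs : T ≤ d * s := tripleAgreement_le σ p
    have hterm : ∀ x y, |(if σ p.1.1 x = σ p.1.2 x then
        g (agreements σ) - g (agreements (swapAt p.1.1 x y σ) + Pi.single p 1) else 0)|
        ≤ (if σ p.1.1 x = σ p.1.2 x then coincidences σ p x y else 0) * B := by
      intro x y
      split_ifs with hx
      · by_cases heq : agreements (swapAt p.1.1 x y σ) + Pi.single p 1 = agreements σ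
        · rw [heq, sub_self, abs_zero]
          exact mul_nonneg (coincidences_nonneg σ p x y) hB0
        · have h1 := one_le_coincidences hx heq
          have h2 : |g (agreements σ)| ≤ C * A ^ (s + (2 * Fintype.card (IndexPair d) + 1)) := by
            refine (hg _).trans ?_
            gcongr
            exact Nat.le_add_right _ _
          have h3 : |g (agreements (swapAt p.1.1 x y σ) + Pi.single p 1)|
              ≤ C * A ^ (s + (2 * Fintype.card (IndexPair d) + 1)) := by
            refine (hg _).trans ?_
            gcongr
            exact totalAgreement_swapAt_add_le σ p.1.1 x y p
          calc |g (agreements σ) - g (agreements (swapAt p.1.1 x y σ) + Pi.single p 1)|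
              ≤ 1 * B := by
                refine (abs_sub _ _).trans ((add_le_add h2 h3).trans_eq ?_)
                rw [hB, hD, pow_add]; ring
            _ ≤ _ := by gcongr
      · simp
    have hs2 : (s : ℝ) ≤ 2 ^ s := by exact_mod_cast (Nat.lt_two_pow_self (n := s)).le
    have hs3 : (s : ℝ) + 2 ≤ 2 * 2 ^ s := by
      have : s + 2 ≤ 2 * 2 ^ s := by
        have := Nat.lt_two_pow_self (n := s)
        have := Nat.one_le_two_pow (n := s)
        omega
      exact_mod_cast this
    -- Truncation at `K = √N`. The triple agreements `T` have small expectation, but `B` is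
    -- unbounded. In `N * T * B` the part with `K` has mean at most `d * K`, and the part with `B ^
    -- 2 / K` costs `N / K = K` times an exponential moment. The balance gives `O(√N)`, to be
    -- divided by `N`.
    have hBK : B ≤ K + B ^ 2 / K := by
      have hKpos : 0 < K := by linarith
      rcases le_total B K with h | h
      · have : 0 ≤ B ^ 2 / K := by positivity
        linarith
      · have : B ≤ B ^ 2 / K := by
          rw [le_div_iff₀ hKpos]; nlinarith
        linarith
    calc |∑ x, ∑ y, (if σ p.1.1 x = σ p.1.2 x then
          g (agreements σ) - g (agreements (swapAt p.1.1 x y σ) + Pi.single p 1) else 0)|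
        ≤ ∑ x, ∑ y, (if σ p.1.1 x = σ p.1.2 x then coincidences σ p x y else 0) * B := by
          refine (Finset.abs_sum_le_sum_abs _ _).trans (Finset.sum_le_sum fun x _ => ?_)
          exact (Finset.abs_sum_le_sum_abs _ _).trans (Finset.sum_le_sum fun y _ => hterm x y)
      _ = (∑ x, ∑ y, (if σ p.1.1 x = σ p.1.2 x then coincidences σ p x y else 0)) * B := by
          simp only [Finset.sum_mul]
      _ ≤ (d * (s * (s + 2)) + N * T) * B := by
          gcongr
          exact sum_coincidences_le σ p
      _ = d * (s * (s + 2)) * B + N * (T * B) := by ring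
      _ ≤ d * (2 ^ s * (2 * 2 ^ s)) * B + N * (T * (K + B ^ 2 / K)) := by gcongr
      _ = d * (2 ^ s * (2 * 2 ^ s)) * B + (N * K * T + N / K * (T * B ^ 2)) := by ring
      _ ≤ d * (2 ^ s * (2 * 2 ^ s)) * B + (N * K * T + N / K * (d * 2 ^ s * B ^ 2)) := by
          gcongr
          exact hTs.trans (by gcongr)
      _ = _ := by
          have e4 : (4 : ℝ) ^ s = 2 ^ s * 2 ^ s := by rw [← mul_pow]; norm_num
          rw [hB, mul_pow 4, mul_pow 2 (A ^ 2), e4, ← pow_mul, mul_comm 2 s, pow_mul]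
          ring
  have h1 : |(N : ℝ) * (∫ σ, (agreements σ p : ℝ) * g (agreements σ) ∂(permLaw d N)
      - ∫ σ, g (agreements σ + Pi.single p 1) ∂(permLaw d N))|
      ≤ 2 * d * D * M₁ + N * K * (d / N) + N / K * (d * D ^ 2) * M₂ := by
    rw [natCast_mul_steinDifference_eq]
    refine abs_integral_le_integral_abs.trans ?_
    refine (integral_mono Integrable.of_finite Integrable.of_finite hpt).trans ?_
    rw [integral_add Integrable.of_finite Integrable.of_finite,
      integral_add Integrable.of_finite Integrable.of_finite, integral_const_mul,
      integral_const_mul, integral_const_mul]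
    gcongr
    · exact hM₁ N
    · exact integral_tripleAgreement_le hN p
    · exact hM₂ N
  rw [abs_mul, abs_of_nonneg (by linarith : (0 : ℝ) ≤ N)] at h1
  rw [le_div_iff₀ (by linarith)]
  have hNK : (N : ℝ) / K = K := by
    rw [div_eq_iff (by linarith)]; exact hK2.symm
  have hKd : N * K * (d / N : ℝ) = K * d := by field_simp
  rw [hNK, hKd] at h1
  set Q := |∫ σ, (agreements σ p : ℝ) * g (agreements σ) ∂(permLaw d N)
      - ∫ σ, g (agreements σ + Pi.single p 1) ∂(permLaw d N)| with hQ
  have h2 : K * (Q * K) ≤ K * (2 * d * D * M₁ + d + d * D ^ 2 * M₂) := by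
    calc K * (Q * K) = N * Q := by rw [← hK2]; ring
      _ ≤ 2 * d * D * M₁ + K * d + K * (d * D ^ 2) * M₂ := h1
      _ ≤ K * (2 * d * D * M₁) + K * d + K * (d * D ^ 2) * M₂ := by
          have : 0 ≤ 2 * d * D * M₁ := by positivity
          nlinarith
      _ = _ := by ring
  exact le_of_mul_le_mul_left h2 (by linarith)

theorem prod_choose_le_two_pow {I : Type*} [Fintype I] (n k : I → ℕ) :
    ∏ q, ((n q).choose (k q) : ℝ) ≤ 2 ^ ∑ q, n q := by
  rw [← Finset.prod_pow_eq_pow_sum]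
  refine Finset.prod_le_prod (fun q _ => by positivity) fun q _ => ?_
  exact_mod_cast Nat.choose_le_two_pow (n q) (k q)

/-- The mixed factorial moments of the numbers of agreements converge to those of independent
Poisson variables. -/
theorem tendsto_integral_prod_choose_agreements (k : IndexPair d → ℕ) :
    Tendsto (fun N : ℕ => ∫ σ, ∏ q, ((agreements σ q).choose (k q) : ℝ) ∂(permLaw d N)) atTop
      (𝓝 (∏ q, (1 / (k q).factorial : ℝ))) := by
  induction h : ∑ q, k q generalizing k with
  | zero =>
    have hk : ∀ q, k q = 0 := by simpa using h
    simp [hk]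
  | succ n ih =>
    obtain ⟨p, hp⟩ : ∃ p, k p ≠ 0 := by
      by_contra! hcon
      simp [hcon] at h
    set k' : IndexPair d → ℕ := Function.update k p (k p - 1) with hk'
    have hk'p : k' p = k p - 1 := Function.update_self ..
    have hk'q : ∀ q ≠ p, k' q = k q := fun q hq => Function.update_of_ne hq ..
    have hsplit : ∀ f : IndexPair d → ℕ → ℕ → ℝ, ∀ a b : IndexPair d → ℕ,
        ∏ q, f q (a q) (b q) = f p (a p) (b p) * ∏ q ∈ Finset.univ.erase p, f q (a q) (b q) :=
      fun f a b => (Finset.mul_prod_erase _ _ (Finset.mem_univ p)).symm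
    have hk'sum : ∑ q, k' q = n := by
      have h1 := Finset.add_sum_erase Finset.univ k (Finset.mem_univ p)
      have h2 := Finset.add_sum_erase Finset.univ k' (Finset.mem_univ p)
      have h3 : ∑ q ∈ Finset.univ.erase p, k' q = ∑ q ∈ Finset.univ.erase p, k q :=
        Finset.sum_congr rfl fun q hq => hk'q q (Finset.ne_of_mem_erase hq)
      omega
    -- Chosen by the absorption identity, so that `m p * g m` is `k p` times the binomial product
    -- for `k`, while the shifted `g` is the product for `k'`. The truncated subtraction at `m p =
    -- 0` does no harm: the first relation has the factor `m p`, and the second evaluates `g` only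
    -- where that coordinate is positive.
    let g : (IndexPair d → ℕ) → ℝ := fun m =>
      ((m p - 1).choose (k p - 1) : ℝ) * ∏ q ∈ Finset.univ.erase p, ((m q).choose (k q) : ℝ)
    have hg : ∀ m, |g m| ≤ 1 * 2 ^ ∑ q, m q := by
      intro m
      rw [abs_of_nonneg (by positivity), one_mul]
      refine le_trans ?_ (prod_choose_le_two_pow m k')
      rw [hsplit (fun _ a b => (a.choose b : ℝ)), hk'p]
      have h1 : ∏ q ∈ Finset.univ.erase p, ((m q).choose (k' q) : ℝ)
          = ∏ q ∈ Finset.univ.erase p, ((m q).choose (k q) : ℝ) :=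
        Finset.prod_congr rfl fun q hq => by rw [hk'q q (Finset.ne_of_mem_erase hq)]
      rw [h1]
      refine mul_le_mul_of_nonneg_right ?_ (by positivity)
      exact_mod_cast Nat.choose_le_choose _ (Nat.sub_le _ _)
    have hg1 : ∀ m : IndexPair d → ℕ, (m p : ℝ) * g m
        = k p * ∏ q, ((m q).choose (k q) : ℝ) := by
      intro m
      rw [hsplit (fun _ a b => (a.choose b : ℝ)), ← mul_assoc, ← mul_assoc]
      congr 1
      have : m p * (m p - 1).choose (k p - 1) = k p * (m p).choose (k p) := by
        obtain ⟨j, hj⟩ := Nat.exists_eq_succ_of_ne_zero hp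
        rcases Nat.eq_zero_or_pos (m p) with h0 | h0
        · simp [h0, hj]
        · obtain ⟨l, hl⟩ := Nat.exists_eq_succ_of_ne_zero h0.ne'
          rw [hj, hl, Nat.succ_sub_one, Nat.succ_sub_one, Nat.succ_eq_add_one, Nat.succ_eq_add_one,
            Nat.add_one_mul_choose_eq, mul_comm]
      exact_mod_cast this
    have hg2 : ∀ m : IndexPair d → ℕ, g (m + Pi.single p 1)
        = ∏ q, ((m q).choose (k' q) : ℝ) := by
      intro m
      rw [hsplit (fun _ a b => (a.choose b : ℝ)), hk'p]
      simp only [g, Pi.add_apply, Pi.single_eq_same, Nat.add_sub_cancel]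
      congr 1
      refine Finset.prod_congr rfl fun q hq => ?_
      have hq' := Finset.ne_of_mem_erase hq
      rw [Pi.single_eq_of_ne hq', add_zero, hk'q q hq']
    obtain ⟨M, hM⟩ := exists_abs_steinDifference_le p one_le_two zero_le_one hg
    have hih := ih k' hk'sum
    simp only [hg1, hg2, integral_const_mul] at hM
    have hdiff : Tendsto (fun N : ℕ =>
        (k p : ℝ) * ∫ σ, ∏ q, ((agreements σ q).choose (k q) : ℝ) ∂(permLaw d N)
        - ∫ σ, ∏ q, ((agreements σ q).choose (k' q) : ℝ) ∂(permLaw d N)) atTop (𝓝 0) := by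
      refine squeeze_zero_norm' (a := fun N : ℕ => M / √N) ?_ ?_
      · filter_upwards [eventually_gt_atTop 0] with N hN using hM N hN
      · exact (tendsto_const_nhds (x := M)).div_atTop
          (Real.tendsto_sqrt_atTop.comp tendsto_natCast_atTop_atTop)
    have hlim := (hdiff.add hih).const_mul ((k p : ℝ)⁻¹)
    have hp' : (k p : ℝ) ≠ 0 := by exact_mod_cast hp
    convert! hlim using 2 with N
    · rw [sub_add_cancel, inv_mul_cancel_left₀ hp']
    · rw [zero_add, hsplit (fun _ _ b => (1 / b.factorial : ℝ)) k k,
        hsplit (fun _ _ b => (1 / b.factorial : ℝ)) k k', hk'p, ← mul_assoc]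
      congr 1
      · rw [← Nat.mul_factorial_pred hp]
        push_cast
        field_simp
      · exact Finset.prod_congr rfl fun q hq => by rw [hk'q q (Finset.ne_of_mem_erase hq)]

end FactorialMoments

/-! ### Convergence of expectations from convergence of factorial moments -/

section FactorialMomentMethod

/-- Binomial inversion: `C(n,k) C(k,j) = C(n,j) C(n-j,k-j)` reduces to an alternating row sum. For
`k < j` the exponent is truncated, but the coefficient vanishes. -/
theorem sum_neg_one_pow_mul_choose_mul_choose {n j : ℕ} (hj : j ≤ n) :
    ∑ k ∈ Finset.range (n + 1), (-1 : ℝ) ^ (k - j) * (k.choose j : ℝ) * (n.choose k : ℝ)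
      = if j = n then 1 else 0 := by
  have h1 : ∑ k ∈ Finset.range (n + 1), (-1 : ℝ) ^ (k - j) * (k.choose j : ℝ) * (n.choose k : ℝ)
      = ∑ m ∈ Finset.range (n - j + 1), (-1 : ℝ) ^ m * ((n - j).choose m : ℝ) * (n.choose j : ℝ) := by
    rw [show n + 1 = j + (n - j + 1) by omega, Finset.sum_range_add]
    rw [Finset.sum_eq_zero fun k hk => by
      rw [Nat.choose_eq_zero_of_lt (Finset.mem_range.1 hk)]; simp, zero_add]
    refine Finset.sum_congr rfl fun m hm => ?_
    have hm' : j + m ≤ n := by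
      have := Finset.mem_range.1 hm
      omega
    have h2 := Nat.choose_mul (n := n) (Nat.le_add_right j m)
    rw [Nat.add_sub_cancel_left] at h2 ⊢
    have h3 : ((n.choose (j + m) : ℝ)) * ((j + m).choose j : ℝ)
        = (n.choose j : ℝ) * ((n - j).choose m : ℝ) := by exact_mod_cast h2
    linear_combination (-1 : ℝ) ^ m * h3
  have h4 := Int.alternating_sum_range_choose (n := n - j)
  have h5 : ∑ m ∈ Finset.range (n - j + 1), (-1 : ℝ) ^ m * ((n - j).choose m : ℝ)
      = if n - j = 0 then 1 else 0 := by exact_mod_cast h4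
  rw [h1, ← Finset.sum_mul, h5]
  rcases hj.eq_or_lt with rfl | hlt
  · simp
  · rw [if_neg (by omega), if_neg hlt.ne, zero_mul]

variable {I : Type*} [Fintype I] [DecidableEq I]

/-- The multi-indices that are componentwise at most `n`. -/
def multiIndexBox (n : I → ℕ) : Finset (I → ℕ) := Fintype.piFinset fun q => Finset.range (n q + 1)

theorem mem_multiIndexBox {n k : I → ℕ} : k ∈ multiIndexBox n ↔ ∀ q, k q ≤ n q := by
  simp [multiIndexBox]

/-- The coefficients of the Newton expansion of `h` in products of binomial coefficients. -/
def newtonCoeff (h : (I → ℕ) → ℝ) (k : I → ℕ) : ℝ :=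
  ∑ j ∈ multiIndexBox k, (∏ q, (-1 : ℝ) ^ (k q - j q) * ((k q).choose (j q) : ℝ)) * h j

theorem prod_choose_eq_zero {n k : I → ℕ} (h : k ∉ multiIndexBox n) :
    ∏ q, ((n q).choose (k q) : ℝ) = 0 := by
  rw [mem_multiIndexBox] at h
  push Not at h
  obtain ⟨q, hq⟩ := h
  exact Finset.prod_eq_zero (Finset.mem_univ q) (by rw [Nat.choose_eq_zero_of_lt hq, Nat.cast_zero])

/-- Binomial inversion in each coordinate. Only `k ≤ n` contributes, but summing over all `k` makes
the index set independent of `n`, so that the expansion can be integrated term by term. -/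
theorem hasSum_newton (h : (I → ℕ) → ℝ) (n : I → ℕ) :
    HasSum (fun k => newtonCoeff h k * ∏ q, ((n q).choose (k q) : ℝ)) (h n) := by
  have h0 : h n = ∑ k ∈ multiIndexBox n, newtonCoeff h k * ∏ q, ((n q).choose (k q) : ℝ) := by
    have h1 : ∀ k ∈ multiIndexBox n, newtonCoeff h k * ∏ q, ((n q).choose (k q) : ℝ)
        = ∑ j ∈ multiIndexBox n, h j *
          ∏ q, ((-1 : ℝ) ^ (k q - j q) * ((k q).choose (j q) : ℝ) * ((n q).choose (k q) : ℝ)) := by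
      intro k hk
      rw [mem_multiIndexBox] at hk
      rw [newtonCoeff, Finset.sum_mul]
      have hsub : multiIndexBox k ⊆ multiIndexBox n := fun j hj => by
        rw [mem_multiIndexBox] at hj ⊢
        exact fun q => (hj q).trans (hk q)
      rw [← Finset.sum_subset hsub]
      · refine Finset.sum_congr rfl fun j _ => ?_
        rw [Finset.prod_mul_distrib (f := fun q => (-1 : ℝ) ^ (k q - j q) *
          ((k q).choose (j q) : ℝ))]
        ring
      · intro j _ hj
        rw [Finset.prod_mul_distrib, Finset.prod_mul_distrib, prod_choose_eq_zero hj]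
        ring
    rw [Finset.sum_congr rfl h1, Finset.sum_comm]
    have h2 : ∀ j ∈ multiIndexBox n, ∑ k ∈ multiIndexBox n, h j *
        ∏ q, ((-1 : ℝ) ^ (k q - j q) * ((k q).choose (j q) : ℝ) * ((n q).choose (k q) : ℝ))
        = if j = n then h j else 0 := by
      intro j hj
      rw [mem_multiIndexBox] at hj
      rw [← Finset.mul_sum, multiIndexBox,
        ← Finset.prod_univ_sum (fun q => Finset.range (n q + 1)) fun q k =>
          (-1 : ℝ) ^ (k - j q) * (k.choose (j q) : ℝ) * ((n q).choose k : ℝ)]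
      simp only [fun q => sum_neg_one_pow_mul_choose_mul_choose (hj q)]
      split_ifs with hjn
      · simp [hjn]
      · obtain ⟨q, hq⟩ := Function.ne_iff.1 hjn
        rw [Finset.prod_eq_zero (Finset.mem_univ q) (if_neg hq), mul_zero]
    rw [Finset.sum_congr rfl h2, Finset.sum_ite_eq', if_pos (mem_multiIndexBox.2 fun q => le_rfl)]
  rw [h0]
  exact hasSum_sum_of_ne_finset_zero fun k hk => by rw [prod_choose_eq_zero hk, mul_zero]

variable {h : (I → ℕ) → ℝ} {C A : ℝ}

theorem abs_newtonCoeff_le (hh : ∀ n, |h n| ≤ C * A ^ ∑ q, n q) (k : I → ℕ) :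
    |newtonCoeff h k| ≤ C * (1 + A) ^ ∑ q, k q := by
  calc |newtonCoeff h k|
      ≤ ∑ j ∈ multiIndexBox k, (∏ q, ((k q).choose (j q) : ℝ)) * (C * A ^ ∑ q, j q) := by
        refine (Finset.abs_sum_le_sum_abs _ _).trans (Finset.sum_le_sum fun j _ => ?_)
        rw [abs_mul, Finset.abs_prod]
        refine mul_le_mul (le_of_eq (Finset.prod_congr rfl fun q _ => ?_)) (hh j) (abs_nonneg _)
          (by positivity)
        rw [abs_mul, abs_pow, abs_neg, abs_one, one_pow, one_mul, Nat.abs_cast]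
    _ = C * ∑ j ∈ multiIndexBox k, ∏ q, A ^ j q * ((k q).choose (j q) : ℝ) := by
        rw [Finset.mul_sum]
        refine Finset.sum_congr rfl fun j _ => ?_
        rw [← Finset.prod_pow_eq_pow_sum, Finset.prod_mul_distrib]
        ring
    _ = C * (1 + A) ^ ∑ q, k q := by
        rw [multiIndexBox, ← Finset.prod_univ_sum (fun q => Finset.range (k q + 1)) fun q j =>
          A ^ j * ((k q).choose j : ℝ), ← Finset.prod_pow_eq_pow_sum]
        congr 1
        refine Finset.prod_congr rfl fun q _ => ?_
        rw [add_comm 1 A, add_pow]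
        simp

theorem summable_pow_sum {r : ℝ} (hr0 : 0 ≤ r) (hr1 : r < 1) :
    Summable fun k : I → ℕ => r ^ ∑ q, k q := by
  refine summable_of_sum_le (c := ∏ _q : I, (1 - r)⁻¹) (fun k => by positivity) fun s => ?_
  obtain ⟨n, hn⟩ : ∃ n : I → ℕ, ∀ k ∈ s, k ∈ multiIndexBox n :=
    ⟨fun q => s.sup fun k => k q, fun k hk => mem_multiIndexBox.2 fun q =>
      Finset.le_sup (f := fun k : I → ℕ => k q) hk⟩
  calc ∑ k ∈ s, r ^ ∑ q, k q ≤ ∑ k ∈ multiIndexBox n, r ^ ∑ q, k q :=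
        Finset.sum_le_sum_of_subset_of_nonneg hn fun k _ _ => by positivity
    _ = ∏ q, ∑ j ∈ Finset.range (n q + 1), r ^ j := by
        simp_rw [← Finset.prod_pow_eq_pow_sum]
        rw [multiIndexBox, ← Finset.prod_univ_sum (fun q => Finset.range (n q + 1)) fun q j => r ^ j]
    _ ≤ _ := Finset.prod_le_prod (fun q _ => by positivity) fun q _ => by
        rw [← tsum_geometric_of_lt_one hr0 hr1]
        exact (summable_geometric_of_lt_one hr0 hr1).sum_le_tsum _ fun _ _ => by positivity

/-- The coefficient grows at most like `(1 + A) ^ |k|`. Inserting `2 ^ |k|` buys the summable factor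
`(1/2) ^ |k|`; the rest, `(2 * (1 + A)) ^ k * C(n, k)`, is one term of a binomial expansion in each
coordinate. The variables `k` and `n` are thereby separated. -/
theorem abs_newtonCoeff_mul_prod_choose_le (hA : 0 ≤ A) (hC : 0 ≤ C)
    (hh : ∀ n, |h n| ≤ C * A ^ ∑ q, n q) (k n : I → ℕ) :
    |newtonCoeff h k| * ∏ q, ((n q).choose (k q) : ℝ)
      ≤ C * (1 / 2) ^ (∑ q, k q) * (1 + 2 * (1 + A)) ^ ∑ q, n q := by
  calc |newtonCoeff h k| * ∏ q, ((n q).choose (k q) : ℝ)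
      ≤ C * (1 + A) ^ (∑ q, k q) * ∏ q, ((n q).choose (k q) : ℝ) := by
        gcongr
        exact abs_newtonCoeff_le hh k
    _ = C * (1 / 2) ^ (∑ q, k q) * ∏ q, (2 * (1 + A)) ^ k q * ((n q).choose (k q) : ℝ) := by
        rw [Finset.prod_mul_distrib, Finset.prod_pow_eq_pow_sum, mul_pow 2]
        have : ((1 : ℝ) / 2) ^ (∑ q, k q) * 2 ^ (∑ q, k q) = 1 := by
          rw [← mul_pow]; norm_num
        linear_combination (-C * (1 + A) ^ (∑ q, k q) * ∏ q, ((n q).choose (k q) : ℝ)) * this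
    _ ≤ C * (1 / 2) ^ (∑ q, k q) * (1 + 2 * (1 + A)) ^ ∑ q, n q := by
        rw [← Finset.prod_pow_eq_pow_sum Finset.univ n]
        gcongr with q
        rcases le_or_gt (k q) (n q) with hle | hlt
        · rw [add_comm 1 (2 * (1 + A)), add_pow]
          simp only [one_pow, mul_one]
          exact Finset.single_le_sum (f := fun j => (2 * (1 + A)) ^ j * ((n q).choose j : ℝ))
            (fun j _ => by positivity) (Finset.mem_range.2 (Nat.lt_succ_of_le hle))
        · rw [Nat.choose_eq_zero_of_lt hlt]
          simp only [Nat.cast_zero, mul_zero]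
          positivity

theorem integrable_of_abs_le_pow {I : Type*} [Fintype I] {μ : Measure (I → ℕ)} {g : (I → ℕ) → ℝ} {C A : ℝ}
    (hint : Integrable (fun n => A ^ ∑ q, n q) μ)
    (hg : ∀ n, |g n| ≤ C * A ^ ∑ q, n q) : Integrable g μ :=
  (hint.const_mul C).mono' (Measurable.of_discrete).aestronglyMeasurable
    (Eventually.of_forall hg)

theorem hasSum_integral_newton {μ : Measure (I → ℕ)} (hA : 0 ≤ A) (hC : 0 ≤ C) (hh : ∀ n, |h n| ≤ C * A ^ ∑ q, n q)
    (hint : ∀ A : ℝ, 1 ≤ A → Integrable (fun n : I → ℕ => A ^ ∑ q, n q) μ) :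
    HasSum (fun k => newtonCoeff h k * ∫ n, ∏ q, ((n q).choose (k q) : ℝ) ∂μ) (∫ n, h n ∂μ) := by
  have hb := abs_newtonCoeff_mul_prod_choose_le hA hC hh
  have hI : ∀ k, Integrable (fun n => newtonCoeff h k * ∏ q, ((n q).choose (k q) : ℝ)) μ := by
    intro k
    refine integrable_of_abs_le_pow (C := C * (1 / 2) ^ (∑ q, k q))
      (hint (1 + 2 * (1 + A)) (by linarith)) fun n => ?_
    rw [abs_mul, abs_of_nonneg (by positivity : 0 ≤ ∏ q, ((n q).choose (k q) : ℝ))]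
    exact hb k n
  have hS : Summable fun k => ∫ n, ‖newtonCoeff h k * ∏ q, ((n q).choose (k q) : ℝ)‖ ∂μ := by
    refine Summable.of_nonneg_of_le (fun k => integral_nonneg fun n => norm_nonneg _) (fun k => ?_)
      ((summable_pow_sum (I := I) (r := 1 / 2) (by norm_num) (by norm_num)).mul_left
        (C * ∫ n, (1 + 2 * (1 + A)) ^ ∑ q, n q ∂μ))
    calc ∫ n, ‖newtonCoeff h k * ∏ q, ((n q).choose (k q) : ℝ)‖ ∂μ
        ≤ ∫ n, C * (1 / 2) ^ (∑ q, k q) * (1 + 2 * (1 + A)) ^ ∑ q, n q ∂μ := by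
          refine integral_mono (hI k).norm ((hint _ (by linarith)).const_mul _) fun n => ?_
          rw [Real.norm_eq_abs, abs_mul,
            abs_of_nonneg (by positivity : 0 ≤ ∏ q, ((n q).choose (k q) : ℝ))]
          exact hb k n
      _ = _ := by rw [integral_const_mul]; ring
  have := hasSum_integral_of_summable_integral_norm hI hS
  simp only [fun n => (hasSum_newton h n).tsum_eq, integral_const_mul] at this
  exact this

/-- Convergence of the mixed factorial moments implies convergence of the expectations of all
functions of at most exponential growth, if the exponential moments are bounded. -/
theorem tendsto_integral_of_tendsto_integral_choose {μ : ℕ → Measure (I → ℕ)}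
    {ν : Measure (I → ℕ)}
    (hμ : ∀ A : ℝ, 1 ≤ A → ∀ N, Integrable (fun n : I → ℕ => A ^ ∑ q, n q) (μ N))
    (hM : ∀ A : ℝ, 1 ≤ A → ∃ M : ℝ, ∀ N, ∫ n, A ^ ∑ q, n q ∂(μ N) ≤ M)
    (hν : ∀ A : ℝ, 1 ≤ A → Integrable (fun n : I → ℕ => A ^ ∑ q, n q) ν)
    (hc : ∀ k : I → ℕ, Tendsto (fun N => ∫ n, ∏ q, ((n q).choose (k q) : ℝ) ∂(μ N)) atTop
      (𝓝 (∫ n, ∏ q, ((n q).choose (k q) : ℝ) ∂ν)))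
    (hA : 0 ≤ A) (hC : 0 ≤ C) (hh : ∀ n, |h n| ≤ C * A ^ ∑ q, n q) :
    Tendsto (fun N => ∫ n, h n ∂(μ N)) atTop (𝓝 (∫ n, h n ∂ν)) := by
  obtain ⟨M, hM⟩ := hM (1 + 2 * (1 + A)) (by linarith)
  have hb := abs_newtonCoeff_mul_prod_choose_le hA hC hh
  simp_rw [← fun N => (hasSum_integral_newton hA hC hh fun A hA => hμ A hA N).tsum_eq]
  rw [← (hasSum_integral_newton hA hC hh hν).tsum_eq]
  -- The dominating series is geometric in `k` and does not depend on `N`, thanks to the uniform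
  -- exponential moment `M`.
  refine tendsto_tsum_of_dominated_convergence (bound := fun k => C * M * (1 / 2) ^ ∑ q, k q)
    ((summable_pow_sum (by norm_num) (by norm_num)).mul_left _)
    (fun k => (hc k).const_mul _) (Eventually.of_forall fun N k => ?_)
  rw [norm_mul, Real.norm_eq_abs, Real.norm_of_nonneg (integral_nonneg fun n => by positivity),
    ← integral_const_mul]
  calc ∫ n, |newtonCoeff h k| * ∏ q, ((n q).choose (k q) : ℝ) ∂(μ N)
      ≤ ∫ n, C * (1 / 2) ^ (∑ q, k q) * (1 + 2 * (1 + A)) ^ ∑ q, n q ∂(μ N) := by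
        refine integral_mono_of_nonneg (Eventually.of_forall fun n => by positivity)
          ((hμ _ (by linarith) N).const_mul _) (Eventually.of_forall fun n => hb k n)
    _ = C * (1 / 2) ^ (∑ q, k q) * ∫ n, (1 + 2 * (1 + A)) ^ ∑ q, n q ∂(μ N) :=
        integral_const_mul _ _
    _ ≤ C * (1 / 2) ^ (∑ q, k q) * M := by
        gcongr
        exact hM N
    _ = _ := by ring

end FactorialMomentMethod

/-! ### Moments of independent Poisson variables -/

section Poisson

theorem integrable_pow_poissonMeasure (A : ℝ) :
    Integrable (fun n : ℕ => A ^ n) (poissonMeasure 1) := by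
  rw [integrable_poissonMeasure_iff]
  have := (Real.summable_pow_div_factorial |A|).mul_left (Real.exp (-1))
  refine this.congr fun n => ?_
  simp only [NNReal.coe_one, one_pow, norm_pow, Real.norm_eq_abs]
  ring

/-- The terms below `k` vanish, and after a shift by `k` the series is the total Poisson mass
divided by `k!`. -/
theorem integral_choose_poissonMeasure (k : ℕ) :
    ∫ n, (n.choose k : ℝ) ∂(poissonMeasure 1) = 1 / k.factorial := by
  rw [integral_poissonMeasure]
  simp only [NNReal.coe_one, one_pow, mul_one, smul_eq_mul]
  have h1 : HasSum (fun m : ℕ => Real.exp (-1) / ((m + k).factorial : ℝ) * ((m + k).choose k : ℝ))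
      (1 / k.factorial) := by
    have h2 := (hasSum_one_poissonMeasure 1).mul_right (1 / k.factorial : ℝ)
    simp only [NNReal.coe_one, one_pow, mul_one, one_mul] at h2
    have h5 : (fun m : ℕ => Real.exp (-1) / ((m + k).factorial : ℝ) * ((m + k).choose k : ℝ))
        = fun m : ℕ => Real.exp (-1) / (m.factorial : ℝ) * (1 / k.factorial) := by
      funext m
      have h3 : ((m + k).choose k : ℝ) * m.factorial * k.factorial = (m + k).factorial := by
        exact_mod_cast Nat.add_choose_mul_factorial_mul_factorial m k
      have h4 : ((m + k).factorial : ℝ) ≠ 0 := by positivity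
      field_simp
      linear_combination h3
    rw [h5]
    exact h2
  have h2 := (hasSum_nat_add_iff (f := fun m : ℕ => Real.exp (-1) / (m.factorial : ℝ) *
    (m.choose k : ℝ)) k).1 h1
  rw [Finset.sum_eq_zero fun n hn => by
    rw [Nat.choose_eq_zero_of_lt (Finset.mem_range.1 hn)]; simp, add_zero] at h2
  exact h2.tsum_eq

variable {I : Type*} [Fintype I]

theorem integrable_pow_pi_poissonMeasure (A : ℝ) :
    Integrable (fun n : I → ℕ => A ^ ∑ q, n q) (Measure.pi fun _ => poissonMeasure 1) := by
  simp_rw [← Finset.prod_pow_eq_pow_sum]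
  exact Integrable.fintype_prod fun _ => integrable_pow_poissonMeasure A

theorem integral_prod_choose_pi_poissonMeasure (k : I → ℕ) :
    ∫ n, ∏ q, ((n q).choose (k q) : ℝ) ∂(Measure.pi fun _ => poissonMeasure 1)
      = ∏ q, (1 / (k q).factorial : ℝ) := by
  refine (integral_fintype_prod_eq_prod (𝕜 := ℝ) (μ := fun _ : I => poissonMeasure 1)
    fun q n => (n.choose (k q) : ℝ)).trans ?_
  simp only [integral_choose_poissonMeasure]

end Poisson

/-! ### The limit law of the agreement numbers -/

section LimitLaw

variable {d : ℕ}

/-- The expectation of a function of at most exponential growth of the agreement numbers converges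
to its expectation under independent Poisson variables. -/
theorem tendsto_integral_agreements {h : (IndexPair d → ℕ) → ℝ} {C A : ℝ} (hA : 0 ≤ A)
    (hC : 0 ≤ C) (hh : ∀ n, |h n| ≤ C * A ^ ∑ q, n q) :
    Tendsto (fun N : ℕ => ∫ σ, h (agreements σ) ∂(permLaw d N)) atTop
      (𝓝 (∫ n, h n ∂(Measure.pi fun _ => poissonMeasure 1))) := by
  have hmeas : ∀ N, Measurable (agreements : (Fin d → Equiv.Perm (Fin N)) → IndexPair d → ℕ) :=
    fun N => Measurable.of_discrete
  have hmap : ∀ (N : ℕ) (g : (IndexPair d → ℕ) → ℝ),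
      ∫ n, g n ∂((permLaw d N).map agreements) = ∫ σ, g (agreements σ) ∂(permLaw d N) :=
    fun N g => integral_map (hmeas N).aemeasurable (Measurable.of_discrete).aestronglyMeasurable
  have : ∀ N, IsProbabilityMeasure ((permLaw d N).map (agreements : _ → IndexPair d → ℕ)) :=
    fun N => Measure.isProbabilityMeasure_map (hmeas N).aemeasurable
  simp_rw [← hmap]
  refine tendsto_integral_of_tendsto_integral_choose (fun B _ N => ?_) (fun B hB => ?_)
    (fun B _ => integrable_pow_pi_poissonMeasure B) (fun k => ?_) hA hC hh
  · rw [integrable_map_measure (Measurable.of_discrete).aestronglyMeasurable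
      (hmeas N).aemeasurable]
    exact Integrable.of_finite
  · obtain ⟨M, hM⟩ := exists_integral_pow_totalAgreement_le d hB
    exact ⟨M, fun N => (hmap N _).trans_le (hM N)⟩
  · simp_rw [hmap]
    rw [integral_prod_choose_pi_poissonMeasure]
    exact tendsto_integral_prod_choose_agreements k

/-- The mean equals that of the limiting Poisson variable already at finite `N`; for `N = 0` it
would be 0. -/
theorem integral_agreements {N : ℕ} (hN : 0 < N) (p : IndexPair d) :
    ∫ σ, (agreements σ p : ℝ) ∂(permLaw d N) = 1 := by
  have hN' : (N : ℝ) ≠ 0 := by exact_mod_cast hN.ne'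
  simp only [agreements, ← sum_ite_agree]
  rw [integral_finsetSum _ fun _ _ => Integrable.of_finite]
  have h1 : ∀ x : Fin N, ∫ σ, (if σ p.1.1 x = σ p.1.2 x then 1 else 0 : ℝ) ∂(permLaw d N)
      = (N : ℝ)⁻¹ := by
    intro x
    have h2 := natCast_mul_integral_ite_eq (d := d) p.2.ne x (h := fun _ => 1) fun _ _ => rfl
    rw [integral_const, probReal_univ, one_smul] at h2
    exact (inv_eq_of_mul_eq_one_right h2).symm
  simp [h1, hN']

end LimitLaw

/-! ### Mean, moments and limit law of the norm -/

namespace ContractionSystem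

variable {d : ℕ} (S : ContractionSystem d)

/-- The limit of the fluctuations as a function of the Poisson variables. -/
def limitFluctuation (n : IndexPair d → ℕ) : ℝ :=
  2 * ∑ p : IndexPair d, ((n p : ℝ) - 1) * (S.bergmanIntegral p.1.1 p.1.2).re

theorem meanNormSq_eq {N : ℕ} (hN : 0 < N) : S.meanNormSq N = N * ∑ j, (S.bergmanIntegral j j).re
    + 2 * ∑ p : IndexPair d, (S.bergmanIntegral p.1.1 p.1.2).re := by
  have h1 : ∀ σ : Fin d → Equiv.Perm (Fin N), S.normSq N σ = N * ∑ j, (S.bergmanIntegral j j).re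
      + 2 * ∑ p : IndexPair d, (agreements σ p : ℝ) * (S.bergmanIntegral p.1.1 p.1.2).re :=
    fun σ => S.normSq_eq σ
  simp only [meanNormSq, h1]
  rw [integral_add Integrable.of_finite Integrable.of_finite, integral_const, probReal_univ,
    one_smul, integral_const_mul, integral_finsetSum _ fun _ _ => Integrable.of_finite]
  simp only [integral_mul_const, integral_agreements hN, one_mul]

/-- Centring by the mean cancels the deterministic diagonal and subtracts exactly 1 from each
agreement number. The fluctuation is thus one fixed function of the agreements for all `N > 0`, and
both limits are instances of `tendsto_integral_agreements`. -/
theorem fluctuation_eq {N : ℕ} (hN : 0 < N) (σ : Fin d → Equiv.Perm (Fin N)) :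
    S.fluctuation N σ = S.limitFluctuation (agreements σ) := by
  rw [fluctuation, S.meanNormSq_eq hN, S.normSq_eq σ, limitFluctuation]
  simp only [agreements, sub_mul, one_mul, Finset.sum_sub_distrib]
  ring

theorem tendsto_meanNormSq_div :
    Tendsto (fun N : ℕ => S.meanNormSq N / N) atTop (𝓝 (∑ j, (S.bergmanIntegral j j).re)) := by
  have h1 := (tendsto_const_nhds (x := 2 * ∑ p : IndexPair d,
    (S.bergmanIntegral p.1.1 p.1.2).re)).div_atTop (tendsto_natCast_atTop_atTop (R := ℝ))
  have h2 := (tendsto_const_nhds (x := ∑ j, (S.bergmanIntegral j j).re) (f := atTop)).add h1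
  rw [add_zero] at h2
  refine h2.congr' ?_
  filter_upwards [eventually_gt_atTop 0] with N hN
  have hN' : (N : ℝ) ≠ 0 := by exact_mod_cast hN.ne'
  rw [S.meanNormSq_eq hN]
  field_simp

theorem abs_limitFluctuation_le (n : IndexPair d → ℕ) :
    |S.limitFluctuation n| ≤ (2 * ∑ p : IndexPair d, |(S.bergmanIntegral p.1.1 p.1.2).re|)
      * 2 ^ ∑ q, n q := by
  rw [limitFluctuation, abs_mul, abs_two, mul_assoc, Finset.sum_mul]
  gcongr
  refine (Finset.abs_sum_le_sum_abs _ _).trans (Finset.sum_le_sum fun p _ => ?_)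
  rw [abs_mul, mul_comm]
  gcongr
  have h1 : n p ≤ ∑ q, n q := Finset.single_le_sum (fun _ _ => Nat.zero_le _) (Finset.mem_univ p)
  have h2 : (n p : ℝ) ≤ 2 ^ ∑ q, n q := by
    exact_mod_cast h1.trans (Nat.lt_two_pow_self).le
  have h3 : (1 : ℝ) ≤ 2 ^ ∑ q, n q := one_le_pow₀ one_le_two
  rw [abs_le]
  constructor <;> linarith [(Nat.cast_nonneg (n p) : (0 : ℝ) ≤ n p)]

theorem tendsto_moment_fluctuation (m : ℕ) :
    Tendsto (fun N : ℕ => ∫ σ, |S.fluctuation N σ| ^ m ∂(permLaw d N)) atTop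
      (𝓝 (∫ n, |S.limitFluctuation n| ^ m ∂(Measure.pi fun _ => poissonMeasure 1))) := by
  refine (tendsto_integral_agreements (h := fun n => |S.limitFluctuation n| ^ m)
    (C := (2 * ∑ p : IndexPair d, |(S.bergmanIntegral p.1.1 p.1.2).re|) ^ m) (A := 2 ^ m)
    (by positivity) (by positivity) fun n => ?_).congr' ?_
  · rw [abs_pow, abs_abs, ← pow_mul, mul_comm m, pow_mul, ← mul_pow]
    gcongr
    exact S.abs_limitFluctuation_le n
  · filter_upwards [eventually_gt_atTop 0] with N hN
    simp only [S.fluctuation_eq hN]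

theorem tendstoInDistribution_fluctuation {Ω' : Type*} [MeasurableSpace Ω'] (P : Measure Ω')
    [IsProbabilityMeasure P] (Z : IndexPair d → Ω' → ℕ)
    (hZ : ∀ p, HasLaw (Z p) (poissonMeasure 1) P) (hind : iIndepFun Z P) :
    TendstoInDistribution (fun N : ℕ => S.fluctuation N) atTop
      (fun ω => S.limitFluctuation fun p => Z p ω) (fun N => permLaw d N) P := by
  have hZm : AEMeasurable (fun ω p => Z p ω) P :=
    aemeasurable_pi_lambda _ fun p => (hZ p).aemeasurable
  have hlim : Measurable S.limitFluctuation := Measurable.of_discrete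
  have hlaw : P.map (fun ω p => Z p ω) = Measure.pi fun _ => poissonMeasure 1 := by
    rw [(iIndepFun_iff_map_fun_eq_pi_map fun p => (hZ p).aemeasurable).1 hind]
    congr 1
    funext p
    exact (hZ p).map_eq
  have hcomp : AEMeasurable (fun ω => S.limitFluctuation fun p => Z p ω) P :=
    hlim.comp_aemeasurable hZm
  refine ⟨fun N => (Measurable.of_discrete).aemeasurable, hcomp, ?_⟩
  refine ProbabilityMeasure.tendsto_iff_forall_integral_tendsto.2 fun f => ?_
  change Tendsto (fun N => ∫ x, f x ∂((permLaw d N).map (S.fluctuation N))) atTop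
    (𝓝 (∫ x, f x ∂(P.map fun ω => S.limitFluctuation fun p => Z p ω)))
  have h1 : ∫ x, f x ∂(P.map fun ω => S.limitFluctuation fun p => Z p ω)
      = ∫ n, f (S.limitFluctuation n) ∂(Measure.pi fun _ => poissonMeasure 1) := by
    rw [integral_map hcomp f.continuous.aestronglyMeasurable, ← hlaw,
      integral_map hZm (Measurable.of_discrete).aestronglyMeasurable]
  rw [h1]
  -- A bounded test function falls under the growth condition with `A = 1`, so convergence in law
  -- needs no tightness or uniqueness argument for moments.
  refine (tendsto_integral_agreements (h := fun n => f (S.limitFluctuation n)) (C := ‖f‖) (A := 1)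
    zero_le_one (norm_nonneg _) fun n => ?_).congr' ?_
  · rw [one_pow, mul_one]
    exact f.norm_coe_le_norm _
  · filter_upwards [eventually_gt_atTop 0] with N hN
    rw [integral_map (Measurable.of_discrete).aemeasurable f.continuous.aestronglyMeasurable]
    simp only [S.fluctuation_eq hN]

end ContractionSystem

end

theorem proposition1p3 {d : ℕ} (hd : 2 ≤ d) (S : ContractionSystem d) :
    -- the quantities in the statement are well defined
    (∀ (N : ℕ) (σ : Fin d → Equiv.Perm (Fin N)),
      IsCompactOperator (S.transferOperator N σ) ∧
      Summable fun j => singularValue (S.transferOperator N σ) j ^ 2) ∧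
    (∀ i j : Fin d, IntegrableOn (S.bergmanIntegrand i j) (S.Ω : Set ℂ)) ∧
    -- (1)
    (∃ L₁ : ℝ, 0 < L₁ ∧
      (L₁ : ℂ) = ∑ j : Fin d, ∫ z in (S.Ω : Set ℂ),
        (‖Complex.exp (S.G (S.γ j z))‖ ^ 2 : ℝ) * Bergman.kernel S.Ω (S.γ j z) (S.γ j z) ∧
      Tendsto (fun N : ℕ => S.meanNormSq N / N) atTop (𝓝 L₁)) ∧
    -- (2)
    (∀ k : ℕ, 1 ≤ k → ∃ L : ℝ,
      Tendsto (fun N : ℕ => ∫ σ, |S.fluctuation N σ| ^ (2 * k) ∂(permLaw d N)) atTop (𝓝 L)) ∧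
    -- (3)
    (∀ {Ω' : Type*} [MeasurableSpace Ω'] (P : Measure Ω') [IsProbabilityMeasure P]
      (Z : {p : Fin d × Fin d // p.1 < p.2} → Ω' → ℕ),
      (∀ p, HasLaw (Z p) (poissonMeasure 1) P) → iIndepFun Z P →
      TendstoInDistribution (fun N : ℕ => S.fluctuation N) atTop
        (fun ω => 2 * ∑ p : {p : Fin d × Fin d // p.1 < p.2},
          ((Z p ω : ℝ) - 1) * (S.bergmanIntegral p.1.1 p.1.2).re)
        (fun N => permLaw d N) P) := by
  refine ⟨fun N σ => ?_, S.integrableOn_bergmanIntegrand, ?_, ?_, ?_⟩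
  · have h := S.isCompactOperator_transferOperator_and_hasSum σ
    exact ⟨h.1, h.2.summable⟩
  · refine ⟨∑ j, (S.bergmanIntegral j j).re, ?_, ?_, S.tendsto_meanNormSq_div⟩
    · exact Finset.sum_pos (fun j _ => S.bergmanIntegral_self_re_pos j)
        ⟨⟨0, by omega⟩, Finset.mem_univ _⟩
    · rw [Complex.ofReal_sum]
      refine Finset.sum_congr rfl fun j _ => ?_
      rw [← S.bergmanIntegral_self_eq]
      -- Hermitian symmetry makes the diagonal integrals real, so their real parts carry the whole
      -- complex value.
      exact Complex.conj_eq_iff_re.1 (S.conj_bergmanIntegral j j)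
  · exact fun k _ => ⟨_, S.tendsto_moment_fluctuation (2 * k)⟩
  · intro Ω' _ P _ Z hZ hind
    exact S.tendstoInDistribution_fluctuation P Z hZ hind
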